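/- **Definitions.** Rows and columns are numbered from $1$; $\ell(\gamma)$ is the number of parts of a partition $\gamma$, and $SST_{m}(\lambda)$ is the set of semistandard tableaux of shape $\lambda$ with entries in $\{1,\dots,m\}$. $T[k]$ denotes the number of entries $k$ in $T$. *Recording tableaux.* Let $\mu\subseteq\lambda$ be partitions with $\ell(\lambda)\le 2n$, $\ell(\mu)\le n$. A Littlewood–Richardson–Sundaram tableau of shape $\lambda/\mu$ is a semistandard skew tableau $T$ of shape $\lambda/\mu$ with entries in $\{1,\dots,2n\}$ such that its reverse column word (columns from right to left, each from top to bottom) is Yamanouchi, its weight $(T[1],T[2],\dots)$ is a partition with $T[2i-1]=T[2i]$ for all $i\ge1$, and its entry in row $n+i$ of the first column, if that cell exists, is at least $2i$ for $i\ge 0$. Then $\lozenge T$ is the filling of $\lambda/\mu$ obtained by replacing, for every $m$, the $k$-th entry $m$ from the right by $k$; and $Rec_{2n}(\lambda/\mu)$ is the set of all $\lozenge T$. *Slacks.* Let $Q\in Rec_{2n}(\lambda/\mu)$ and let $N$ be its largest entry ($0$ if $\lambda=\mu$). For $0\le k\le N$ let $\mu^{(k)}$ be the partition whose diagram consists of $\mu$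 and the cells of $\lambda/\mu$ with entry at least $k+1$ in $Q$, so that $\mu^{(0)}=\lambda$, $\mu^{(N)}=\mu$, and $\mu^{(k-1)}/\mu^{(k)}$ is a vertical strip with $Q[k]$ cells. The slack vector $\mathbf r^{(k)}$ is the set of $r\in[1,\ell(\mu^{(k)})]$ such that the strip $\mu^{(k-1)}/\mu^{(k)}$ has no cell in row $r$; the slack $t_0^{(k)}$ is $\ell(\mu^{(k)})$ minus the number of cells of the strip in the rows $1,\dots,\ell(\mu^{(k)})$. The slack sequence is $(t_0^{(N)},\dots,t_0^{(1)})$ and the slack vector sequence is $[\mathbf r^{(N)},\dots,\mathbf r^{(1)}]$; one-element slack vectors $\{r\}$ are written $r$ and the empty one $()$. *The map $LR^{AII}$.* For a column $\mathbf a=(a_1<\dots<a_l)$ put $\mathrm{rem}(\mathbf a)=\emptyset$ if $l\le1$; for $l\ge 2$ put $\mathrm{rem}(\mathbf a)=\mathrm{rem}(a_1,\dots,a_{l-2})\cup\{a_{l-1},a_l\}$ if $a_l$ is even, $a_{l-1}=a_l-1$ and $a_l<2l-|\mathrm{rem}(a_1,\dots,a_{l-2})|-1$, and $\mathrm{rem}(\mathbf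 a)=\mathrm{rem}(a_1,\dots,a_{l-1})$ otherwise. Put $\mathrm{red}(\mathbf a)=\mathbf a\setminus \mathrm{rem}(\mathbf a)$. For a tableau $T$ with first column $T_1$ and remaining part $T_{\ge2}$, $\mathrm{suc}(T)$ is obtained by Schensted column insertion of the entries of $\mathrm{red}(T_1)$, from the smallest to the largest, into $T_{\ge2}$. Iterating $\mathrm{suc}$ from $T\in SST_{2n}(\lambda)$ becomes stationary; $P^{AII}(T)$ is the limit, $Q^{AII}(T)$ is the filling of shape $\lambda/\mathrm{sh}(P^{AII}(T))$ in which a cell has entry $k$ if it belongs to the shape of $\mathrm{suc}^{k-1}(T)$ but not to that of $\mathrm{suc}^{k}(T)$, and $LR^{AII}(T)=(P^{AII}(T),Q^{AII}(T))$. *Highest weight tableaux.* Let $u_k=2k-\frac{1+(-1)^k}2$ and $v_k=2k-\frac{1+(-1)^{k+1}}2$. Let $S^{H}=S^{H,\mu}$ be the tableau of shape $\mu$ whose $k$-th row is filled with $u_k$ (for $n=2$: first row $2$'s, second row $3$'s). A tableau $T\in SST_{2n}(\lambda)$ is a $\mathfrak k$-highest weight tableau if $P^{AII}(T)=S^{H,\kappa}$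 for some partition $\kappa$ with $\ell(\kappa)\le n$. Its $\mathfrak k$-weight is $(T[u_1]-T[v_1],\dots,T[u_n]-T[v_n])$. *Types.* A tableau is of type (1) if its columns, from left to right, are $(1,2,3,4)^a,(1,2,3)^x,(1,2,4)^y,(1,2)^p,(2,3)^z,(2)^w$, and of type (2) if they are $(1,2,3,4)^a,(1,2,3)^x,(1,2,4)^y,(2,3,4)^q,(2,3)^z,(2)^w$, where the exponents are multiplicities $\ge0$. **Statement.** Let $n=2$, let $\mu\subseteq\lambda$ be partitions with $\ell(\lambda)\le4$ and $\ell(\mu)\le2$, and let $Q\in Rec_4(\lambda/\mu)$. Then: 1. The slack sequence and the slack vector sequence of $Q$ are of the form $(1,\dots,1,0,\dots,0)$ and $(1,\dots,1,2,\dots,2,3,\dots,3,(),\dots,())$ respectively, where each block may be empty and the entries $()$ stand at the places of the slacks $0$. 2. There is exactly one $T\in SST_4(\lambda)$ with $LR^{AII}(T)=(S^{H,\mu},Q)$, that is, $T=(LR^{AII})^{-1}(S^{H,\mu},Q)$. It is a $\mathfrak k$-highest weight tableau of $\mathfrak k$-weight $\mu$, and it is of type (1) or of type (2). If $x,y,z,w$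 are the numbers of columns of $T$ equal to $(1,2,3)$, $(1,2,4)$, $(2,3)$ and $(2)$ respectively, then $x\le w$ and $y\le z$. Let $\#1$ and $\#3$ be the numbers of entries $1$ and $3$ in the slack vector sequence of $Q$. - If $\#3>\#1$, then $T$ is of type (1). - If no vertical strip of $Q$ has both slack $0$ and exactly two cells, then $T$ is of type (2) if and only if $\#3\le\#1$. - If some vertical strip of $Q$ has slack $0$ and exactly two cells, then all slacks of $Q$ are $0$ (so $\#1=\#3=0$), and $T$ is of type (1) and not of type (2). -/

import Mathlib

/-! Partitions are Young diagrams: `lam.colLen 0` is the number of parts, `lam.rowLen i` is the part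
of index `i + 1`. Cells are pairs (row, column) numbered from `0`. Fillings are functions
`ℕ → ℕ → ℕ`, with the value `0` on empty cells and outside the diagram. -/

namespace QuantumLR

/-! ### Semistandard tableaux and their weights -/

/-- Semistandard tableaux of shape `lam` with entries in `[1, m]`. -/
def SST (m : ℕ) (lam : YoungDiagram) : Set (SemistandardYoungTableau lam) :=
  {T | ∀ i j, (i, j) ∈ lam → 1 ≤ T i j ∧ T i j ≤ m}

/-- The number of cells of `s` whose entry is `k`. -/
def occ (s : Finset (ℕ × ℕ)) (T : ℕ → ℕ → ℕ) (k : ℕ) : ℕ :=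
  (s.filter fun c => T c.1 c.2 = k).card

/-- The list of columns of a tableau, from left to right, each one read from top to bottom. -/
def columns {lam : YoungDiagram} (T : SemistandardYoungTableau lam) : List (List ℕ) :=
  (List.range (lam.rowLen 0)).map fun j => (List.range (lam.colLen j)).map fun i => T i j

/-! ### Littlewood-Richardson-Sundaram tableaux and recording tableaux -/

/-- Semistandard tableaux of skew shape `lam / mu` with entries in `[1, m]`. -/
structure IsSkewSST (m : ℕ) (lam mu : YoungDiagram) (T : ℕ → ℕ → ℕ) : Prop where
  zero_outside : ∀ i j, (i, j) ∉ lam → T i j = 0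
  zero_inner : ∀ i j, (i, j) ∈ mu → T i j = 0
  range : ∀ i j, (i, j) ∈ lam → (i, j) ∉ mu → 1 ≤ T i j ∧ T i j ≤ m
  row_weak : ∀ i j₁ j₂, j₁ < j₂ → (i, j₂) ∈ lam → T i j₁ ≤ T i j₂
  col_strict : ∀ i₁ i₂ j, i₁ < i₂ → (i₁, j) ∉ mu → (i₂, j) ∈ lam → T i₁ j < T i₂ j

/-- The cells read not later than `c` when the columns are read from right to left, each one from
top to bottom. -/
def readUpTo (lam : YoungDiagram) (c : ℕ × ℕ) : Finset (ℕ × ℕ) :=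
  lam.cells.filter fun d => c.2 < d.2 ∨ (d.2 = c.2 ∧ d.1 ≤ c.1)

/-- The `n`-symplectic Littlewood-Richardson (Littlewood-Richardson-Sundaram) tableaux of shape
`lam / mu`. -/
structure IsLRS (n : ℕ) (lam mu : YoungDiagram) (T : ℕ → ℕ → ℕ) : Prop where
  skew : IsSkewSST (2 * n) lam mu T
  /-- The reverse column word is a Yamanouchi word. -/
  yamanouchi : ∀ c ∈ lam.cells, ∀ k, 1 ≤ k →
    occ (readUpTo lam c) T (k + 1) ≤ occ (readUpTo lam c) T k
  /-- The weight is a partition. -/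
  weight_anti : ∀ k, 1 ≤ k → occ lam.cells T (k + 1) ≤ occ lam.cells T k
  /-- The partition is even: its parts of index `2i - 1` and `2i` agree. -/
  weight_even : ∀ i, 1 ≤ i → occ lam.cells T (2 * i - 1) = occ lam.cells T (2 * i)
  /-- The entry in the first column and the row number `n + i` (counted from `1`) is at least
  `2i`. -/
  sundaram : ∀ i, 1 ≤ i → (n + i - 1, 0) ∈ lam → 2 * i ≤ T (n + i - 1) 0

/-- The relabelling `◊` of a Littlewood-Richardson tableau: the `k`-th entry `m` from the right
is replaced by `k`, for all `m`. So the `k`-th vertical strip, which consists of the `k`-th entries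
`1, 2, …` from the right, is filled with `k`'s. -/
def lozenge (lam : YoungDiagram) (T : ℕ → ℕ → ℕ) : ℕ → ℕ → ℕ := fun i j =>
  if T i j = 0 then 0 else (lam.cells.filter fun c => T c.1 c.2 = T i j ∧ j ≤ c.2).card

/-- The set `Rec_{2n}(lam / mu)` of recording tableaux. -/
def Rec (n : ℕ) (lam mu : YoungDiagram) : Set (ℕ → ℕ → ℕ) :=
  lozenge lam '' {T | IsLRS n lam mu T}

/-! ### Slacks of a recording tableau -/

/-- The number `N` of vertical strips of `Q`: its largest entry. -/
def numStrips (lam : YoungDiagram) (Q : ℕ → ℕ → ℕ) : ℕ :=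
  lam.cells.sup fun c => Q c.1 c.2

/-- The cells of `μ^{(k)}`: those of `mu` and those with an entry at least `k + 1`. -/
def nested (lam mu : YoungDiagram) (Q : ℕ → ℕ → ℕ) (k : ℕ) : Finset (ℕ × ℕ) :=
  mu.cells ∪ lam.cells.filter fun c => k + 1 ≤ Q c.1 c.2

/-- The length of `μ^{(k)}`: the number of its rows. -/
def nestedLength (lam mu : YoungDiagram) (Q : ℕ → ℕ → ℕ) (k : ℕ) : ℕ :=
  ((nested lam mu Q k).image Prod.fst).card

/-- The set of row coordinates, counted from `1`, of the cells of the vertical strip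
`μ^{(k-1)} / μ^{(k)}`. -/
def stripRows (lam mu : YoungDiagram) (Q : ℕ → ℕ → ℕ) (k : ℕ) : Finset ℕ :=
  (nested lam mu Q (k - 1) \ nested lam mu Q k).image fun c => c.1 + 1

/-- The slack row index vector `r^{(k)}`, as a set: the complement in `[1, ℓ(μ^{(k)})]` of the set
of row coordinates of the strip `μ^{(k-1)} / μ^{(k)}`. -/
def slackVector (lam mu : YoungDiagram) (Q : ℕ → ℕ → ℕ) (k : ℕ) : Finset ℕ :=
  Finset.Icc 1 (nestedLength lam mu Q k) \ stripRows lam mu Q k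

/-- The slack `t₀^{(k)}`: `ℓ(μ^{(k)})` minus the number of cells of the strip `μ^{(k-1)} / μ^{(k)}`
with row coordinate in `[1, ℓ(μ^{(k)})]`. -/
def slack (lam mu : YoungDiagram) (Q : ℕ → ℕ → ℕ) (k : ℕ) : ℤ :=
  (nestedLength lam mu Q k : ℤ) -
    ((nested lam mu Q (k - 1) \ nested lam mu Q k).filter
      fun c => c.1 + 1 ≤ nestedLength lam mu Q k).card

/-- The slack sequence `(t₀^{(N)}, …, t₀^{(1)})`. -/
def slackSequence (lam mu : YoungDiagram) (Q : ℕ → ℕ → ℕ) : List ℤ :=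
  (List.range (numStrips lam Q)).map fun i => slack lam mu Q (numStrips lam Q - i)

/-- The slack (row index) vector sequence `[r^{(N)}, …, r^{(1)}]`. -/
def slackVectorSequence (lam mu : YoungDiagram) (Q : ℕ → ℕ → ℕ) : List (Finset ℕ) :=
  (List.range (numStrips lam Q)).map fun i => slackVector lam mu Q (numStrips lam Q - i)

/-! ### The quantum Littlewood-Richardson map of type AII

Here a tableau is given by the list of its columns. -/

/-- The removed entries of a column `a₁ < ⋯ < a_l`, given in the order `a_l, …, a₁`: if `a_l` is
even, `a_{l-1} = a_l - 1` and `a_l < 2l - |rem(a₁, …, a_{l-2})| - 1`, then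
`rem(a₁, …, a_l) = rem(a₁, …, a_{l-2}) ∪ {a_{l-1}, a_l}`; otherwise
`rem(a₁, …, a_l) = rem(a₁, …, a_{l-1})`. -/
def remRev : List ℕ → List ℕ
  | [] => []
  | [_] => []
  | b :: a :: t =>
    if Even b ∧ a + 1 = b ∧ b + (remRev t).length + 1 < 2 * (t.length + 2) then
      b :: a :: remRev t
    else remRev (a :: t)

/-- The reduction `red(a) = a \ rem(a)` of a column. -/
def red (a : List ℕ) : List ℕ := a.filter fun x => x ∉ remRev a.reverse

/-- Insertion of `x` into a column: `x` replaces the smallest entry `≥ x`, which is returned, or is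
put at the bottom if there is none. -/
def bump (x : ℕ) : List ℕ → List ℕ × Option ℕ
  | [] => ([x], none)
  | y :: c => if x ≤ y then (x :: c, some y) else (y :: (bump x c).1, (bump x c).2)

/-- Schensted column insertion `x → T`. -/
def colInsert (x : ℕ) : List (List ℕ) → List (List ℕ)
  | [] => [[x]]
  | c :: t =>
    match bump x c with
    | (c', none) => c' :: t
    | (c', some y) => c' :: colInsert y t

/-- The product of a column `a = (w₁ < ⋯ < w_k)` and a tableau `T` in the plactic monoid,
`w_k → (⋯ → (w₂ → (w₁ → T)))`. -/
def colProd (a : List ℕ) (T : List (List ℕ)) : List (List ℕ) :=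
  a.foldl (fun t x => colInsert x t) T

/-- The successor of a tableau: its first column is reduced, and the result is multiplied with
the rest. -/
def suc : List (List ℕ) → List (List ℕ)
  | [] => []
  | c :: t => colProd (red c) t

/-- `P^{AII}`: the successor map is iterated until it becomes stationary. Every step that changes
the tableau makes it smaller, so as many steps as there are cells suffice. -/
def PAII (T : List (List ℕ)) : List (List ℕ) := suc^[(T.map List.length).sum] T

/-- `(i, j)` is a cell of the tableau `T`. -/
def HasCell (T : List (List ℕ)) (i j : ℕ) : Prop := i < (T.getD j []).length

/-- `Q^{AII}`: the entry in a cell is the number of the step at which the cell disappears from the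
shape, and `0` if it never does (the set is then empty) or if it is not a cell of `T`. -/
noncomputable def QAII (T : List (List ℕ)) : ℕ → ℕ → ℕ := fun i j =>
  sInf {k | ¬ HasCell (suc^[k] T) i j}

/-- The map `LR^{AII}`, with values `(P^{AII}(T), Q^{AII}(T))`. -/
noncomputable def LRAII {lam : YoungDiagram} (T : SemistandardYoungTableau lam) :
    List (List ℕ) × (ℕ → ℕ → ℕ) :=
  (PAII (columns T), QAII (columns T))

/-! ### Highest weight tableaux for `k` -/

/-- `u_k = 2k - (1 + (-1)^k) / 2` for `k ≥ 1`: the numbers `2, 3, 6, 7, …`. -/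
def uSeq (k : ℕ) : ℕ := 2 * k - if Even k then 1 else 0

/-- `v_k = 2k - (1 + (-1)^(k+1)) / 2` for `k ≥ 1`: the numbers `1, 4, 5, 8, …`. -/
def vSeq (k : ℕ) : ℕ := 2 * k - if Even k then 0 else 1

lemma uSeq_lt {i j : ℕ} (h : i < j) : uSeq (i + 1) < uSeq (j + 1) := by
  unfold uSeq
  rcases Nat.even_or_odd (i + 1) with h₁ | h₁ <;> rcases Nat.even_or_odd (j + 1) with h₂ | h₂ <;>
    simp only [Nat.even_iff, Nat.odd_iff] at * <;> split_ifs <;> omega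

/-- The tableau `S^H` of shape `mu` whose row number `k` is filled with `u_k`. -/
def highestTableau (mu : YoungDiagram) : SemistandardYoungTableau mu where
  entry i j := if (i, j) ∈ mu then uSeq (i + 1) else 0
  row_weak' hj hcell := by
    rw [if_pos hcell, if_pos (mu.up_left_mem le_rfl hj.le hcell)]
  col_strict' hi hcell := by
    rw [if_pos hcell, if_pos (mu.up_left_mem hi.le le_rfl hcell)]
    exact uSeq_lt hi
  zeros' h := if_neg h

/-- `T` is a `k`-highest weight tableau: `P^{AII}(T)` has the form `S^H`, for some shape with at
most `n` rows. -/
def IsKHighest (n : ℕ) {lam : YoungDiagram} (T : SemistandardYoungTableau lam) : Prop :=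
  ∃ mu : YoungDiagram, mu.colLen 0 ≤ n ∧ PAII (columns T) = columns (highestTableau mu)

/-- The `k`-weight of `T`: its coordinate of index `k ∈ [1, n]` is `T[u_k] - T[v_k]`. -/
def kWeight {lam : YoungDiagram} (T : SemistandardYoungTableau lam) (k : ℕ) : ℤ :=
  (occ lam.cells T (uSeq k) : ℤ) - occ lam.cells T (vSeq k)

/-! ### The two types of tableaux for `n = 2` -/

/-- First type: from left to right, columns `(1,2,3,4)`, `(1,2,3)`, `(1,2,4)`, `(1,2)`, `(2,3)`,
`(2)`, each one with some multiplicity `≥ 0`. -/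
def IsType1 {lam : YoungDiagram} (T : SemistandardYoungTableau lam) : Prop :=
  ∃ a x y p z w : ℕ, columns T =
    List.replicate a [1, 2, 3, 4] ++ List.replicate x [1, 2, 3] ++ List.replicate y [1, 2, 4] ++
      List.replicate p [1, 2] ++ List.replicate z [2, 3] ++ List.replicate w [2]

/-- Second type: from left to right, columns `(1,2,3,4)`, `(1,2,3)`, `(1,2,4)`, `(2,3,4)`, `(2,3)`,
`(2)`, each one with some multiplicity `≥ 0`. -/
def IsType2 {lam : YoungDiagram} (T : SemistandardYoungTableau lam) : Prop :=
  ∃ a x y q z w : ℕ, columns T =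
    List.replicate a [1, 2, 3, 4] ++ List.replicate x [1, 2, 3] ++ List.replicate y [1, 2, 4] ++
      List.replicate q [2, 3, 4] ++ List.replicate z [2, 3] ++ List.replicate w [2]

end QuantumLR

open QuantumLR

/-!
For `n = 2` everything is explicit.

*The recording tableau.* The Yamanouchi condition bounds the entries of a row by its number, and
Sundaram's condition excludes `1` from the third row and `1, 2, 3` from the fourth one. So a
Littlewood-Richardson-Sundaram tableau is given by the numbers `p`, `q` of entries `1` in the first
and second row, `s`, `e` of entries `2` in the second and third row, and `b` of entries `3` and of
entries `4`, with `p + q = s + e` and `b ≤ s ≤ p` (`IsLRS.isRecording`). Of the `p + q` vertical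
strips of `Q`, those with index in `[1, b]`, `(b, s]`, `(s, p]`, `(p, p + q]` lie in the rows
`1234`, `12`, `13`, `23` respectively, and the slacks are read off (`IsRecording.slack_cases`,
`IsRecording.sequences_eq`).

*Existence.* On tableaux with the columns `(1,2,3,4)^a (1,2,3)^x (1,2,4)^y (1,2)^p (2,3,4)^r (2,3)^z
(2)^w`, where `p = 0` or `r = 0`, the successor map changes the multiplicities in a simple way: it
takes away the columns `(1,2,3,4)`, then `(1,2)`, then turns a `(1,2,4)` and a `(2,3)` into a
`(2,3,4)`, then a `(1,2,3)` and a `(2)` into a `(2,3)`, and finally a `(2,3,4)` into a `(2)`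
(`iterate_suc_mixed`). The rows that lose a cell are `1234`, `12`, `12`, `13`, `23`, so the
multiplicities can be chosen such that the recording tableau is `Q` (`IsRecording.QAII_mixed`): the
numbers of columns `(1,2)` and `(2,3,4)` are the truncated differences of `s - b` and `q`.

*Uniqueness.* The recording tableau determines the shapes of all successors, because shapes only
shrink (`length_colProd_le`). The successor map is injective on tableaux of a given shape
(`suc_injective`): inserting an increasing column `a` into a column `c` can be undone if the length
of `c` is known (`multiBump_injective`), the bumped entries form again an increasing column that is
inserted into the next one (`colProd_cons`, `multiBump_snd_sublist`), and a column with entries in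
`[1, 4]` is determined by its length and its reduction (`red_injective`).
-/

namespace QuantumLR

/-! ### Column insertion of a whole column -/

/-- Either `x` exceeds all entries of the column and is put at the bottom, or it replaces the first
entry `y ≥ x`. -/
lemma bump_cases (x : ℕ) (c : List ℕ) :
    ((∀ z ∈ c, z < x) ∧ bump x c = (c ++ [x], none)) ∨
      ∃ l y r, c = l ++ y :: r ∧ (∀ z ∈ l, z < x) ∧ x ≤ y ∧
        bump x c = (l ++ x :: r, some y) := by
  induction c with
  | nil => simp [bump]
  | cons d c ih =>
    by_cases h : x ≤ d
    · exact Or.inr ⟨[], d, c, by simp [bump, h]⟩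
    · rcases ih with ⟨h₁, h₂⟩ | ⟨l, y, r, rfl, h₁, h₂, h₃⟩
      · left
        refine ⟨by simpa using ⟨by omega, h₁⟩, by simp [bump, h, h₂]⟩
      · right
        exact ⟨d :: l, y, r, by simp, by simpa using ⟨by omega, h₁⟩, h₂, by simp [bump, h, h₃]⟩

lemma bump_mem {x z : ℕ} {c : List ℕ} (h : z ∈ (bump x c).1) : z = x ∨ z ∈ c := by
  rcases bump_cases x c with ⟨-, h₂⟩ | ⟨l, y, r, rfl, -, -, h₂⟩ <;> simp [h₂] at h ⊢ <;> tauto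

lemma bump_snd_mem {x y : ℕ} {c : List ℕ} (h : (bump x c).2 = some y) : y ∈ c ∧ x ≤ y := by
  rcases bump_cases x c with ⟨-, h₂⟩ | ⟨l, y', r, rfl, -, h₁, h₂⟩ <;> simp [h₂] at h
  subst h
  simpa using h₁

lemma bump_ne_nil (x : ℕ) (c : List ℕ) : (bump x c).1 ≠ [] := by
  rcases bump_cases x c with ⟨-, h₂⟩ | ⟨l, y', r, rfl, -, h₁, h₂⟩ <;> simp [h₂]

lemma bump_sorted {x : ℕ} {c : List ℕ} (hc : c.Pairwise (· < ·)) :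
    (bump x c).1.Pairwise (· < ·) := by
  rcases bump_cases x c with ⟨h₁, h₂⟩ | ⟨l, y, r, rfl, h₁, h₃, h₂⟩
  · rw [h₂]
    simpa [List.pairwise_append] using ⟨hc, h₁⟩
  · rw [h₂]
    simp only [List.pairwise_append, List.pairwise_cons, List.mem_cons] at hc ⊢
    refine ⟨hc.1, ⟨fun z hz => by have := hc.2.1.1 z hz; omega, hc.2.1.2⟩, ?_⟩
    rintro a ha b (rfl | hb)
    · exact h₁ a ha
    · exact hc.2.2 a ha b (Or.inr hb)

/-- Insertion of the entries of `a`, one after another, into the single column `c`: the new column,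
and the list of the entries that are bumped out of it. -/
def multiBump : List ℕ → List ℕ → List ℕ × List ℕ
  | [], c => (c, [])
  | x :: a, c => ((multiBump a (bump x c).1).1, (bump x c).2.toList ++ (multiBump a (bump x c).1).2)

/-- The insertion of a column proceeds through a tableau column by column: the entries bumped out
of the first column are inserted into the rest. -/
lemma colProd_cons (a c : List ℕ) (t : List (List ℕ)) :
    colProd a (c :: t) = (multiBump a c).1 :: colProd (multiBump a c).2 t := by
  induction a generalizing c t with
  | nil => rfl
  | cons x a ih =>
    have h : colProd (x :: a) (c :: t) = colProd a (colInsert x (c :: t)) := rfl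
    rcases hb : bump x c with ⟨c', _ | y⟩
    · rw [h, show colInsert x (c :: t) = c' :: t by simp [colInsert, hb], ih]
      simp [multiBump, hb]
    · rw [h, show colInsert x (c :: t) = c' :: colInsert y t by simp [colInsert, hb], ih]
      simp [multiBump, hb, colProd]

lemma multiBump_eq_append {a c : List ℕ} (ha : a.Pairwise (· < ·)) (h : ∀ z ∈ c, ∀ x ∈ a, z < x) :
    multiBump a c = (c ++ a, []) := by
  induction a generalizing c with
  | nil => simp [multiBump]
  | cons x a ih =>
    rw [List.pairwise_cons] at ha
    have hb : bump x c = (c ++ [x], none) := by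
      rcases bump_cases x c with ⟨-, h₂⟩ | ⟨l, y, r, rfl, -, h₃, -⟩
      · exact h₂
      · have := h y (by simp) x (by simp)
        omega
    have := ih (c := c ++ [x]) ha.2 (by
      intro z hz x' hx'
      rcases List.mem_append.1 hz with hz | hz
      · exact h z hz x' (by simp [hx'])
      · rw [List.mem_singleton.1 hz]
        exact ha.1 x' hx')
    simp [multiBump, hb, this]

lemma bump_append {x : ℕ} {l r : List ℕ} (h : ∀ z ∈ l, z < x) :
    bump x (l ++ r) = (l ++ (bump x r).1, (bump x r).2) := by
  induction l with
  | nil => rfl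
  | cons d l ih =>
    have hd : ¬ x ≤ d := by have := h d (by simp); omega
    have := ih fun z hz => h z (by simp [hz])
    simp [bump, hd, this]

lemma multiBump_append {a l r : List ℕ} (h : ∀ z ∈ l, ∀ x ∈ a, z < x) :
    multiBump a (l ++ r) = (l ++ (multiBump a r).1, (multiBump a r).2) := by
  induction a generalizing r with
  | nil => rfl
  | cons x a ih =>
    have h₁ := bump_append (x := x) (l := l) (r := r) fun z hz => h z hz x (by simp)
    have h₂ := ih (r := (bump x r).1) fun z hz x' hx' => h z hz x' (by simp [hx'])
    simp [multiBump, h₁, h₂]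

/-- The entries of an increasing column `a` bump old entries only, and in increasing order. -/
lemma multiBump_snd_sublist {a c : List ℕ} (ha : a.Pairwise (· < ·)) (hc : c.Pairwise (· < ·)) :
    (multiBump a c).2.Sublist c := by
  induction a generalizing c with
  | nil => simp [multiBump]
  | cons x a ih =>
    rcases bump_cases x c with ⟨h₁, h₂⟩ | ⟨l, y, r, rfl, h₁, h₃, h₂⟩
    · rw [multiBump_eq_append ha]
      · simp
      · intro z hz x' hx'
        have := h₁ z hz
        rcases List.mem_cons.1 hx' with rfl | hx'
        · exact this
        · exact this.trans ((List.pairwise_cons.1 ha).1 x' hx')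
    · rw [List.pairwise_cons] at ha
      have h₄ : multiBump a (l ++ x :: r) =
          ((l ++ [x]) ++ (multiBump a r).1, (multiBump a r).2) := by
        rw [show l ++ x :: r = (l ++ [x]) ++ r by simp]
        refine multiBump_append fun z hz x' hx' => ?_
        have := ha.1 x' hx'
        rcases List.mem_append.1 hz with hz | hz
        · exact (h₁ z hz).trans this
        · rw [List.mem_singleton.1 hz]
          exact this
      have h₅ := ih ha.2 (c := r) (List.pairwise_cons.1 (List.pairwise_append.1 hc).2.1).2
      simp only [multiBump, h₂, h₄, Option.toList_some, List.singleton_append]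
      exact (h₅.cons_cons y).trans (List.sublist_append_right l (y :: r))

lemma length_multiBump (a c : List ℕ) :
    (multiBump a c).1.length + (multiBump a c).2.length = a.length + c.length := by
  induction a generalizing c with
  | nil => simp [multiBump]
  | cons x a ih =>
    have := ih (bump x c).1
    rcases bump_cases x c with ⟨h₁, h₂⟩ | ⟨l, y, r, rfl, h₁, h₃, h₂⟩ <;>
      simp only [multiBump, h₂] at this ⊢ <;> simp at this ⊢ <;> omega

/-- Reverse bumping: `y` has replaced the last entry `≤ y`. -/
lemma bump_injective {x x' y : ℕ} {c d e : List ℕ} (hc : c.Pairwise (· < ·))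
    (hd : d.Pairwise (· < ·)) (h : bump x c = (e, some y)) (h' : bump x' d = (e, some y)) :
    x = x' ∧ c = d := by
  have key : ∀ {x : ℕ} {c : List ℕ}, c.Pairwise (· < ·) → bump x c = (e, some y) →
      ∃ l r, c = l ++ y :: r ∧ l ++ [x] = e.filter (· ≤ y) ∧ r = e.filter (fun z => y < z) := by
    intro x c hc h
    rcases bump_cases x c with ⟨h₁, h₂⟩ | ⟨l, y', r, rfl, h₁, h₃, h₂⟩
    · simp [h₂] at h
    · rw [h₂, Prod.mk.injEq, Option.some.injEq] at h
      obtain ⟨rfl, rfl⟩ := h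
      rw [List.pairwise_append, List.pairwise_cons] at hc
      have hl : ∀ z ∈ l, z ≤ y' := fun z hz => (hc.2.2 z hz y' (by simp)).le
      have hr : ∀ z ∈ r, y' < z := hc.2.1.1
      refine ⟨l, r, rfl, ?_, ?_⟩
      · rw [List.filter_append, List.filter_eq_self.2 (by simpa using hl),
          List.filter_cons_of_pos (by simpa using h₃), List.filter_eq_nil_iff.2 (by simpa using hr)]
      · rw [List.filter_append, List.filter_eq_nil_iff.2 (by simpa using hl),
          List.filter_cons_of_neg (by simpa using h₃), List.filter_eq_self.2 (by simpa using hr)]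
        simp
  obtain ⟨l, r, rfl, h₁, rfl⟩ := key hc h
  obtain ⟨l', r', rfl, h₂, rfl⟩ := key hd h'
  have := List.append_inj' (h₁.trans h₂.symm) rfl
  simp_all

lemma multiBump_injective {a a' c c' : List ℕ} (ha : a.Pairwise (· < ·))
    (ha' : a'.Pairwise (· < ·)) (hc : c.Pairwise (· < ·)) (hc' : c'.Pairwise (· < ·))
    (hl : a.length = a'.length) (hl' : c.length = c'.length)
    (h : multiBump a c = multiBump a' c') : a = a' ∧ c = c' := by
  have happ : ∀ {x : ℕ} {a c : List ℕ}, (x :: a).Pairwise (· < ·) → (∀ z ∈ c, z < x) →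
      multiBump (x :: a) c = (c ++ x :: a, []) := by
    intro x a c ha h
    refine multiBump_eq_append ha fun z hz x' hx' => ?_
    rcases List.mem_cons.1 hx' with rfl | hx'
    · exact h z hz
    · exact (h z hz).trans ((List.pairwise_cons.1 ha).1 x' hx')
  induction a generalizing a' c c' with
  | nil =>
    obtain rfl : a' = [] := List.length_eq_zero_iff.1 hl.symm
    simpa [multiBump] using h
  | cons x a ih =>
    obtain _ | ⟨x', a'⟩ := a'
    · simp at hl
    rcases bump_cases x c with ⟨h₁, h₂⟩ | ⟨l, y, r, h₀, h₁, h₃, h₂⟩ <;>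
    rcases bump_cases x' c' with ⟨h₁', h₂'⟩ | ⟨l', y', r', h₀', h₁', h₃', h₂'⟩
    · rw [happ ha h₁, happ ha' h₁', Prod.mk.injEq] at h
      exact (List.append_inj h.1 hl').symm
    · rw [happ ha h₁] at h
      simp [multiBump, h₂'] at h
    · rw [happ ha' h₁'] at h
      simp [multiBump, h₂] at h
    · have s := bump_sorted (x := x) hc
      have s' := bump_sorted (x := x') hc'
      simp only [multiBump, h₂, h₂', Option.toList_some, List.singleton_append, Prod.mk.injEq,
        List.cons.injEq] at h
      rw [h₂] at s
      rw [h₂'] at s'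
      obtain ⟨rfl, e⟩ := ih (List.pairwise_cons.1 ha).2 (List.pairwise_cons.1 ha').2 s s'
        (by simpa using hl) (by simpa [h₀, h₀'] using hl') (Prod.ext h.1 h.2.2)
      obtain ⟨rfl, rfl⟩ := h.2.1
      simp only at e
      rw [← e] at h₂'
      obtain ⟨rfl, rfl⟩ := bump_injective hc hc' h₂ h₂'
      exact ⟨rfl, rfl⟩

lemma colProd_nil_right {a : List ℕ} (ha : a.Pairwise (· < ·)) :
    colProd a [] = if a = [] then [] else [a] := by
  cases a with
  | nil => rfl
  | cons x a =>
    rw [show colProd (x :: a) [] = colProd a ([x] :: []) from rfl, colProd_cons,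
      multiBump_eq_append (List.pairwise_cons.1 ha).2 (by simpa using (List.pairwise_cons.1 ha).1)]
    simp [colProd]

/-- The factors of the product of a column and a tableau are determined by their shapes. -/
lemma colProd_injective {a a' : List ℕ} {t t' : List (List ℕ)} (ha : a.Pairwise (· < ·))
    (ha' : a'.Pairwise (· < ·)) (ht : ∀ c ∈ t, c.Pairwise (· < ·))
    (ht' : ∀ c ∈ t', c.Pairwise (· < ·)) (hl : a.length = a'.length)
    (hs : t.map List.length = t'.map List.length) (h : colProd a t = colProd a' t') :
    a = a' ∧ t = t' := by
  induction t generalizing a a' t' with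
  | nil =>
    obtain rfl : t' = [] := by simpa using hs.symm
    rw [colProd_nil_right ha, colProd_nil_right ha'] at h
    split_ifs at h <;> simp_all
  | cons c t ih =>
    obtain _ | ⟨c', t'⟩ := t'
    · simp at hs
    simp only [List.map_cons, List.cons.injEq] at hs
    rw [colProd_cons, colProd_cons, List.cons.injEq] at h
    have hc := ht c (by simp)
    have hc' := ht' c' (by simp)
    have e := length_multiBump a c
    have e' := length_multiBump a' c'
    rw [h.1] at e
    obtain ⟨h₁, rfl⟩ := ih (hc.sublist (multiBump_snd_sublist ha hc))
      (hc'.sublist (multiBump_snd_sublist ha' hc')) (fun d hd => ht d (by simp [hd]))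
      (fun d hd => ht' d (by simp [hd])) (by omega) hs.2 h.2
    obtain ⟨rfl, rfl⟩ := multiBump_injective ha ha' hc hc' hl hs.1 (Prod.ext h.1 h₁)
    exact ⟨rfl, rfl⟩

/-! ### The successor map preserves semistandardness and shrinks the shape -/

/-- `Dom c d`: the column `c` can stand to the left of the column `d` in a semistandard tableau. -/
def Dom : List ℕ → List ℕ → Prop
  | _, [] => True
  | [], _ :: _ => False
  | a :: c, b :: d => a ≤ b ∧ Dom c d

lemma Dom.length_le {c d : List ℕ} (h : Dom c d) : d.length ≤ c.length := by
  induction c generalizing d with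
  | nil => cases d <;> simp_all [Dom]
  | cons a c ih =>
    cases d with
    | nil => simp
    | cons b d => simpa using ih h.2

@[simp] lemma dom_nil (c : List ℕ) : Dom c [] := by cases c <;> trivial

lemma Dom.bump_right {x : ℕ} {c d : List ℕ} (h : Dom c d) (hx : x ∈ c) (hc : c.Pairwise (· < ·)) :
    Dom c (bump x d).1 := by
  induction c generalizing d with
  | nil => simp at hx
  | cons a c ih =>
    rw [List.pairwise_cons] at hc
    have hax : a ≤ x := by
      rcases List.mem_cons.1 hx with rfl | hx
      · rfl
      · exact (hc.1 x hx).le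
    cases d with
    | nil => exact ⟨hax, dom_nil c⟩
    | cons b d =>
      by_cases hxb : x ≤ b
      · simpa [bump, hxb, Dom] using ⟨hax, h.2⟩
      · have hx' : x ∈ c := by
          rcases List.mem_cons.1 hx with rfl | hx
          · exact absurd h.1 hxb
          · exact hx
        simpa [bump, hxb, Dom] using ⟨h.1, ih h.2 hx' hc.2⟩

lemma Dom.bump_left {c d : List ℕ} (x : ℕ) (h : Dom c d) : Dom (bump x c).1 d := by
  induction c generalizing d with
  | nil =>
    cases d with
    | nil => simp
    | cons b d => exact h.elim
  | cons a c ih =>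
    cases d with
    | nil => simp
    | cons b d =>
      by_cases hxa : x ≤ a
      · simpa [bump, hxa, Dom] using ⟨hxa.trans h.1, h.2⟩
      · simpa [bump, hxa, Dom] using ⟨h.1, ih h.2⟩

lemma Dom.bump_bump {x y : ℕ} {c d : List ℕ} (h : Dom c d) (hy : (bump x c).2 = some y) :
    Dom (bump x c).1 (bump y d).1 := by
  induction c generalizing d with
  | nil => simp [bump] at hy
  | cons a c ih =>
    by_cases hxa : x ≤ a
    · obtain rfl : a = y := by simpa [bump, hxa] using hy
      cases d with
      | nil => simp [bump, hxa, Dom]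
      | cons b d => simpa [bump, hxa, h.1, Dom] using h.2
    · have hy' : (bump x c).2 = some y := by simpa [bump, hxa] using hy
      have hay : a ≤ y := by have := (bump_snd_mem hy').2; omega
      cases d with
      | nil => simpa [bump, hxa, Dom] using hay
      | cons b d =>
        by_cases hyb : y ≤ b
        · simpa [bump, hxa, hyb, Dom] using ⟨hay, h.2.bump_left x⟩
        · simpa [bump, hxa, hyb, Dom] using ⟨h.1, ih h.2 hy'⟩

/-- Semistandard tableaux with entries in `[1, 4]`, given by their columns, none of which is
empty. -/
def IsTableau : List (List ℕ) → Prop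
  | [] => True
  | c :: t => c ≠ [] ∧ c.Pairwise (· < ·) ∧ (∀ x ∈ c, 1 ≤ x ∧ x ≤ 4) ∧ Dom c (t.headD []) ∧
      IsTableau t

lemma headD_colInsert (x : ℕ) (t : List (List ℕ)) :
    (colInsert x t).headD [] = (bump x (t.headD [])).1 := by
  cases t with
  | nil => rfl
  | cons c t => rcases hb : bump x c with ⟨c', _ | y⟩ <;> simp [colInsert, hb]

lemma IsTableau.colInsert {x : ℕ} {t : List (List ℕ)} (h : IsTableau t) (hx : 1 ≤ x ∧ x ≤ 4) :
    IsTableau (colInsert x t) := by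
  induction t generalizing x with
  | nil => simpa [QuantumLR.colInsert, IsTableau] using hx
  | cons c t ih =>
    obtain ⟨-, h₂, h₃, h₄, h₅⟩ := h
    have n := bump_ne_nil x c
    have s := bump_sorted (x := x) h₂
    have m : ∀ z ∈ (bump x c).1, 1 ≤ z ∧ z ≤ 4 := by
      intro z hz
      rcases bump_mem hz with rfl | hz
      · exact hx
      · exact h₃ z hz
    have d := h₄.bump_left x
    rcases hb : bump x c with ⟨c', _ | y⟩
    · simp only [hb] at n s m d
      rw [show QuantumLR.colInsert x (c :: t) = c' :: t by simp [QuantumLR.colInsert, hb]]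
      exact ⟨n, s, m, d, h₅⟩
    · have hy : (bump x c).2 = some y := by rw [hb]
      have d' := h₄.bump_bump hy
      have t' := ih h₅ (h₃ y (bump_snd_mem hy).1)
      simp only [hb, ← headD_colInsert] at n s m d'
      rw [show QuantumLR.colInsert x (c :: t) = c' :: QuantumLR.colInsert y t by
        simp [QuantumLR.colInsert, hb]]
      exact ⟨n, s, m, d', t'⟩

lemma IsTableau.colProd {a : List ℕ} {t : List (List ℕ)} (h : IsTableau t)
    (ha : ∀ x ∈ a, 1 ≤ x ∧ x ≤ 4) : IsTableau (colProd a t) := by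
  induction a generalizing t with
  | nil => exact h
  | cons x a ih =>
    exact ih (h.colInsert (ha x (by simp))) fun z hz => ha z (by simp [hz])

lemma red_sublist (c : List ℕ) : (red c).Sublist c := List.filter_sublist

lemma IsTableau.suc {t : List (List ℕ)} (h : IsTableau t) : IsTableau (suc t) := by
  cases t with
  | nil => exact h
  | cons c t => exact h.2.2.2.2.colProd fun x hx => h.2.2.1 x ((red_sublist c).subset hx)

lemma IsTableau.iterate_suc {t : List (List ℕ)} (h : IsTableau t) (k : ℕ) :
    IsTableau (QuantumLR.suc^[k] t) := by
  induction k with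
  | zero => exact h
  | succ k ih =>
    rw [Function.iterate_succ_apply']
    exact ih.suc

lemma IsTableau.pairwise {t : List (List ℕ)} (h : IsTableau t) :
    ∀ c ∈ t, c ≠ [] ∧ c.Pairwise (· < ·) := by
  induction t with
  | nil => simp
  | cons c t ih =>
    intro d hd
    rcases List.mem_cons.1 hd with rfl | hd
    · exact ⟨h.1, h.2.1⟩
    · exact ih h.2.2.2.2 d hd

lemma Dom.multiBump_right {a c d : List ℕ} (h : Dom c d) (ha : ∀ x ∈ a, x ∈ c)
    (hc : c.Pairwise (· < ·)) : Dom c (multiBump a d).1 := by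
  induction a generalizing d with
  | nil => exact h
  | cons x a ih =>
    exact ih (h.bump_right (ha x (by simp)) hc) fun z hz => ha z (by simp [hz])

/-- If a part of the first column is multiplied back to the rest of a tableau, no column gets longer
than it was. -/
lemma length_colProd_le {a c : List ℕ} {t : List (List ℕ)} (h : IsTableau (c :: t))
    (ha : a.Sublist c) (j : ℕ) :
    ((colProd a t).getD j []).length ≤ ((c :: t).getD j []).length := by
  induction t generalizing a c j with
  | nil =>
    rw [colProd_nil_right (h.2.1.sublist ha)]
    split_ifs
    · simp
    · cases j
      · simpa using ha.length_le
      · simp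
  | cons d t ih =>
    obtain ⟨-, h₂, -, h₄, h₅⟩ := h
    rw [colProd_cons]
    cases j with
    | zero => simpa using (Dom.multiBump_right h₄ (fun x hx => ha.subset hx) h₂).length_le
    | succ j => simpa using ih h₅ (multiBump_snd_sublist (h₂.sublist ha) h₅.2.1) j

lemma HasCell.of_suc {t : List (List ℕ)} (h : IsTableau t) {i j : ℕ} (hc : HasCell (suc t) i j) :
    HasCell t i j := by
  cases t with
  | nil => exact hc
  | cons c t => exact lt_of_lt_of_le hc (length_colProd_le h (red_sublist c) j)

lemma HasCell.of_iterate_suc {t : List (List ℕ)} (h : IsTableau t) {i j k l : ℕ} (hkl : k ≤ l)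
    (hc : HasCell (suc^[l] t) i j) : HasCell (suc^[k] t) i j := by
  induction l, hkl using Nat.le_induction with
  | base => exact hc
  | succ l _ ih =>
    rw [Function.iterate_succ_apply'] at hc
    exact ih (hc.of_suc (h.iterate_suc l))

/-! ### A tableau is determined by its image under `LR^{AII}` -/

/-- The recording tableau determines the shapes of all successors. -/
lemma hasCell_iterate_suc_iff {t : List (List ℕ)} (h : IsTableau t) (i j k : ℕ) :
    HasCell (suc^[k] t) i j ↔ k < QAII t i j ∨ (QAII t i j = 0 ∧ HasCell t i j) := by
  unfold QAII
  by_cases hne : {k | ¬ HasCell (suc^[k] t) i j}.Nonempty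
  · have hmem := Nat.sInf_mem hne
    set m := sInf {k | ¬ HasCell (suc^[k] t) i j} with hm
    constructor
    · intro hk
      left
      by_contra hlt
      exact hmem (hk.of_iterate_suc h (not_lt.1 hlt))
    · rintro (hk | ⟨h₀, hc⟩)
      · by_contra hn
        exact absurd (Nat.sInf_le (s := {k | ¬ HasCell (suc^[k] t) i j}) hn) (by omega)
      · rw [h₀] at hmem
        exact absurd hc hmem
  · have hall : ∀ k, HasCell (suc^[k] t) i j := by
      intro k
      by_contra hk
      exact hne ⟨k, hk⟩
    rw [Set.not_nonempty_iff_eq_empty.1 hne]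
    simpa [hall k] using hall 0

lemma map_length_eq_of_hasCell {s t : List (List ℕ)} (hs : ∀ c ∈ s, c ≠ []) (ht : ∀ c ∈ t, c ≠ [])
    (h : ∀ i j, HasCell s i j ↔ HasCell t i j) : s.map List.length = t.map List.length := by
  induction s generalizing t with
  | nil =>
    cases t with
    | nil => rfl
    | cons c t =>
      have := (h 0 0).2 (by simpa [HasCell, List.length_pos_iff] using ht c (by simp))
      simp [HasCell] at this
  | cons d s ih =>
    cases t with
    | nil =>
      have := (h 0 0).1 (by simpa [HasCell, List.length_pos_iff] using hs d (by simp))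
      simp [HasCell] at this
    | cons c t =>
      have h₀ : d.length = c.length := by
        have h₁ : ∀ i, i < d.length ↔ i < c.length := fun i => by simpa [HasCell] using h i 0
        have := h₁ d.length
        have := h₁ c.length
        omega
      have := ih (t := t) (fun e he => hs e (by simp [he])) (fun e he => ht e (by simp [he]))
        fun i j => by simpa [HasCell] using h i (j + 1)
      simp [h₀, this]

lemma sublist_of_pairwise {c : List ℕ} (h : c.Pairwise (· < ·)) (hc : ∀ x ∈ c, 1 ≤ x ∧ x ≤ 4) :
    c.Sublist [1, 2, 3, 4] := by
  have e : c = [1, 2, 3, 4].filter (· ∈ c) := by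
    refine List.Perm.eq_of_pairwise (le := (· < ·)) (fun a b _ _ h₁ h₂ => by omega) h
      (List.Pairwise.filter _ (by decide)) ?_
    refine (List.perm_ext_iff_of_nodup (h.imp fun h => h.ne) (List.Nodup.filter _ (by decide))).2 ?_
    intro x
    simp only [List.mem_filter, List.mem_cons, List.not_mem_nil, decide_eq_true_eq]
    constructor
    · intro hx
      have := hc x hx
      exact ⟨by omega, hx⟩
    · exact fun hx => hx.2
  rw [e]
  exact List.filter_sublist

/-- A column with entries in `[1, 4]` is determined by its length and its reduction. -/
lemma red_injective {c d : List ℕ} (hc : c.Sublist [1, 2, 3, 4]) (hd : d.Sublist [1, 2, 3, 4])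
    (hl : c.length = d.length) (h : red c = red d) : c = d := by
  have key : ∀ c ∈ [1, 2, 3, 4].sublists, ∀ d ∈ [1, 2, 3, 4].sublists,
      c.length = d.length → red c = red d → c = d := by decide
  exact key c (List.mem_sublists.2 hc) d (List.mem_sublists.2 hd) hl h

lemma sum_length_colInsert (x : ℕ) (t : List (List ℕ)) :
    ((colInsert x t).map List.length).sum = (t.map List.length).sum + 1 := by
  induction t generalizing x with
  | nil => rfl
  | cons c t ih =>
    rcases bump_cases x c with ⟨-, h₂⟩ | ⟨l, y, r, rfl, -, -, h₂⟩
    · simp [colInsert, h₂]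
      omega
    · have := ih y
      simp [colInsert, h₂] at this ⊢
      omega

lemma sum_length_colProd (a : List ℕ) (t : List (List ℕ)) :
    ((colProd a t).map List.length).sum = (t.map List.length).sum + a.length := by
  induction a generalizing t with
  | nil => rfl
  | cons x a ih =>
    have h₁ := ih (colInsert x t)
    have h₂ := sum_length_colInsert x t
    rw [show colProd (x :: a) t = colProd a (colInsert x t) from rfl, h₁, h₂, List.length_cons]
    omega

/-- The successor map is injective on tableaux of a given shape. -/
lemma suc_injective {s t : List (List ℕ)} (hs : IsTableau s) (ht : IsTableau t)
    (hl : s.map List.length = t.map List.length) (h : suc s = suc t) : s = t := by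
  cases s with
  | nil => simpa using hl.symm
  | cons c s =>
    cases t with
    | nil => simp at hl
    | cons d t =>
      simp only [List.map_cons, List.cons.injEq] at hl
      have h' : colProd (red c) s = colProd (red d) t := h
      have e₁ := sum_length_colProd (red c) s
      have e₂ := sum_length_colProd (red d) t
      rw [h', hl.2] at e₁
      obtain ⟨h₁, rfl⟩ := colProd_injective (hs.2.1.sublist (red_sublist c))
        (ht.2.1.sublist (red_sublist d)) (fun e he => (hs.2.2.2.2.pairwise e he).2)
        (fun e he => (ht.2.2.2.2.pairwise e he).2) (by omega) hl.2 h'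
      rw [red_injective (sublist_of_pairwise hs.2.1 hs.2.2.1)
        (sublist_of_pairwise ht.2.1 ht.2.2.1) hl.1 h₁]

/-- `LR^{AII}` is injective on tableaux of a given shape: the recording tableau gives the shapes of
all successors, so the successor map can be reversed step by step. -/
lemma PAII_QAII_injective {s t : List (List ℕ)} (hs : IsTableau s) (ht : IsTableau t)
    (hl : s.map List.length = t.map List.length) (hP : PAII s = PAII t) (hQ : QAII s = QAII t) :
    s = t := by
  have h₀ : ∀ i j, HasCell s i j ↔ HasCell t i j := by
    have hlen : ∀ (s : List (List ℕ)) j, (s.getD j []).length = (s.map List.length).getD j 0 := by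
      intro s j
      simp [List.getD_eq_getElem?_getD]
      cases s[j]? <;> simp
    intro i j
    rw [HasCell, HasCell, hlen, hlen, hl]
  have hsh : ∀ k, (suc^[k] s).map List.length = (suc^[k] t).map List.length := fun k =>
    map_length_eq_of_hasCell (fun c hc => ((hs.iterate_suc k).pairwise c hc).1)
      (fun c hc => ((ht.iterate_suc k).pairwise c hc).1) fun i j => by
        rw [hasCell_iterate_suc_iff hs, hasCell_iterate_suc_iff ht, hQ, h₀]
  have back : ∀ m, suc^[m] s = suc^[m] t → s = t := by
    intro m
    induction m with
    | zero => exact id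
    | succ m ih =>
      intro h
      rw [Function.iterate_succ_apply', Function.iterate_succ_apply'] at h
      exact ih (suc_injective (hs.iterate_suc m) (ht.iterate_suc m) (hsh m) h)
  refine back (s.map List.length).sum ?_
  rw [PAII, PAII, ← hl] at hP
  exact hP

/-! ### The successor map on the tableaux of both types -/

/-- The tableau with the given multiplicities of columns. It is of the first type if `r = 0`, and of
the second type if `p = 0`. -/
def mixed (a x y p r z w : ℕ) : List (List ℕ) :=
  List.replicate a [1, 2, 3, 4] ++ (List.replicate x [1, 2, 3] ++ (List.replicate y [1, 2, 4] ++
    (List.replicate p [1, 2] ++ (List.replicate r [2, 3, 4] ++ (List.replicate z [2, 3] ++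
      List.replicate w [2])))))

lemma colInsert_replicate {v : ℕ} {c : List ℕ} (h : bump v c = (c, some v)) (m : ℕ)
    (t : List (List ℕ)) :
    colInsert v (List.replicate m c ++ t) = List.replicate m c ++ colInsert v t := by
  induction m with
  | zero => rfl
  | succ m ih => simp [List.replicate_succ, colInsert, h, ih]

lemma colInsert_cons_some {v y : ℕ} {c d : List ℕ} (h : bump v c = (d, some y))
    (t : List (List ℕ)) : colInsert v (c :: t) = d :: colInsert y t := by
  simp [colInsert, h]

lemma colInsert_cons_none {v : ℕ} {c d : List ℕ} (h : bump v c = (d, none))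
    (t : List (List ℕ)) : colInsert v (c :: t) = d :: t := by
  simp [colInsert, h]

lemma replicate_append_cons (m : ℕ) (c : List ℕ) (t : List (List ℕ)) :
    List.replicate m c ++ c :: t = List.replicate (m + 1) c ++ t := by
  simp [List.replicate_succ']

lemma suc_cons_of_red_nil {c : List ℕ} (h : red c = []) (t : List (List ℕ)) :
    suc (c :: t) = t := by
  simp [suc, h, colProd]

lemma suc_cons_of_red_singleton {c : List ℕ} {v : ℕ} (h : red c = [v]) (t : List (List ℕ)) :
    suc (c :: t) = colInsert v t := by
  simp [suc, h, colProd]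

/-- A column `(1,2,3,4)` disappears. -/
lemma suc_mixed_a (a x y p r z w : ℕ) :
    suc (mixed (a + 1) x y p r z w) = mixed a x y p r z w :=
  suc_cons_of_red_nil (by decide) _

/-- A column `(1,2)` disappears: a reduced first column leaves `3` or `4`, which passes through
the columns of length three and ends below a column `(1,2)`. -/
lemma suc_mixed_p (x y p z w : ℕ) :
    suc (mixed 0 x y (p + 1) 0 z w) = mixed 0 x y p 0 z w := by
  have h4 : ∀ y t, colInsert 4 (List.replicate y [1, 2, 4] ++
      (List.replicate (p + 1) [1, 2] ++ t)) =
      List.replicate y [1, 2, 4] ++ [1, 2, 4] :: (List.replicate p [1, 2] ++ t) := by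
    intro y t
    rw [colInsert_replicate rfl, List.replicate_succ, List.cons_append,
      colInsert_cons_none (d := [1, 2, 4]) rfl]
  have h3 : ∀ t, colInsert 3 (List.replicate y [1, 2, 4] ++ (List.replicate (p + 1) [1, 2] ++ t)) =
      [1, 2, 3] :: (List.replicate y [1, 2, 4] ++ (List.replicate p [1, 2] ++ t)) := by
    intro t
    cases y with
    | zero => exact colInsert_cons_none rfl _
    | succ y =>
      rw [List.replicate_succ, List.cons_append, colInsert_cons_some (y := 4) (d := [1, 2, 3]) rfl,
        colInsert_replicate rfl, List.replicate_succ, List.cons_append,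
        colInsert_cons_none (d := [1, 2, 4]) rfl, replicate_append_cons]
      rfl
  cases x with
  | succ x =>
    refine (suc_cons_of_red_singleton (v := 3) (by decide) _).trans ?_
    change colInsert 3 (List.replicate x [1, 2, 3] ++ _) = _
    rw [colInsert_replicate rfl, h3, replicate_append_cons]
    rfl
  | zero =>
    cases y with
    | succ y =>
      refine (suc_cons_of_red_singleton (v := 4) (by decide) _).trans ?_
      change colInsert 4 (List.replicate y [1, 2, 4] ++ (List.replicate (p + 1) [1, 2] ++ _)) = _
      rw [h4, replicate_append_cons]
      rfl
    | zero => exact suc_cons_of_red_nil (by decide) _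

/-- A reduced first column leaves `3` or `4`, which amounts to a column `(1,2,4)` being lost and
a column `(2,3)` being extended to `(2,3,4)`. -/
lemma suc_mixed_y (x y r z w : ℕ) :
    suc (mixed 0 x (y + 1) 0 r (z + 1) w) = mixed 0 x y 0 (r + 1) z w := by
  have h4 : ∀ t, colInsert 4 (List.replicate y [1, 2, 4] ++ (List.replicate r [2, 3, 4] ++
      (List.replicate (z + 1) [2, 3] ++ t))) =
      List.replicate y [1, 2, 4] ++ (List.replicate (r + 1) [2, 3, 4] ++
      (List.replicate z [2, 3] ++ t)) := by
    intro t
    rw [colInsert_replicate rfl, colInsert_replicate rfl, List.replicate_succ, List.cons_append,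
      colInsert_cons_none (d := [2, 3, 4]) rfl, replicate_append_cons]
  cases x with
  | succ x =>
    refine (suc_cons_of_red_singleton (v := 3) (by decide) _).trans ?_
    change colInsert 3 (List.replicate x [1, 2, 3] ++ _) = _
    rw [colInsert_replicate rfl, List.replicate_succ, List.cons_append,
      colInsert_cons_some (y := 4) (d := [1, 2, 3]) rfl]
    refine Eq.trans ?_ (replicate_append_cons x [1, 2, 3] _)
    exact congrArg (fun t => _ ++ _ :: t) (h4 _)
  | zero =>
    refine (suc_cons_of_red_singleton (v := 4) (by decide) _).trans ?_
    exact h4 _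

/-- A column `(1,2,3)` is lost, and a column `(2)` is extended to `(2,3)`. -/
lemma suc_mixed_x (x r z w : ℕ) :
    suc (mixed 0 (x + 1) 0 0 r z (w + 1)) = mixed 0 x 0 0 r (z + 1) w := by
  refine (suc_cons_of_red_singleton (v := 3) (by decide) _).trans ?_
  change colInsert 3 (List.replicate x [1, 2, 3] ++ (List.replicate r [2, 3, 4] ++
    (List.replicate z [2, 3] ++ [2] :: List.replicate w [2]))) = _
  rw [colInsert_replicate rfl, colInsert_replicate rfl, colInsert_replicate rfl,
    colInsert_cons_none rfl]
  exact congrArg (fun t => _ ++ (_ ++ t)) (replicate_append_cons z [2, 3] _)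

/-- A column `(2,3,4)` is replaced with a column `(2)`. -/
lemma suc_mixed_r (r z w : ℕ) :
    suc (mixed 0 0 0 0 (r + 1) z w) = mixed 0 0 0 0 r z (w + 1) := by
  refine (suc_cons_of_red_singleton (v := 2) (by decide) _).trans ?_
  change colInsert 2 (List.replicate r [2, 3, 4] ++
    (List.replicate z [2, 3] ++ List.replicate w [2])) = _
  rw [colInsert_replicate rfl, colInsert_replicate rfl, ← List.append_nil (List.replicate w [2]),
    colInsert_replicate rfl]
  have : List.replicate w [2] ++ colInsert 2 [] = List.replicate (w + 1) [2] := by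
    simpa [colInsert] using replicate_append_cons w [2] []
  rw [this]
  rfl

lemma suc_mixed_fixed (z w : ℕ) : suc (mixed 0 0 0 0 0 z w) = mixed 0 0 0 0 0 z w := by
  have h2 : ∀ w, List.replicate w [2] ++ colInsert 2 [] = [2] :: List.replicate w [2] := by
    intro w
    simpa [colInsert, List.replicate_succ] using replicate_append_cons w [2] []
  cases z with
  | zero =>
    cases w with
    | zero => rfl
    | succ w =>
      refine (suc_cons_of_red_singleton (v := 2) (by decide) _).trans ?_
      rw [← List.append_nil (List.replicate w [2]), colInsert_replicate rfl, h2]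
      rfl
  | succ z =>
    have hred : red [2, 3] = [2, 3] := by decide
    have : suc (mixed 0 0 0 0 0 (z + 1) w) =
        colInsert 3 (colInsert 2 (List.replicate z [2, 3] ++ List.replicate w [2])) := by
      change colProd (red [2, 3]) _ = _
      rw [hred]
      rfl
    rw [this, colInsert_replicate rfl, ← List.append_nil (List.replicate w [2]),
      colInsert_replicate (c := [2]) rfl, h2, colInsert_replicate rfl,
      colInsert_cons_none (d := [2, 3]) rfl]
    exact (replicate_append_cons z [2, 3] _)

/-- The successors of a tableau of the first or the second type: the columns `(1,2,3,4)` are removed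
first, then the columns `(1,2)`, `(1,2,4)`, `(1,2,3)`, `(2,3,4)`, in this order. -/
lemma iterate_suc_mixed {a x y p r z w : ℕ} (hx : x ≤ w) (hy : y ≤ z) (hpr : p = 0 ∨ r = 0)
    (k : ℕ) :
    suc^[k] (mixed a x y p r z w) =
      mixed (a - k) (x - (k - (a + p + y))) (y - (k - (a + p))) (p - (k - a))
        (r + min y (k - (a + p)) - (k - (a + p + y + x)))
        (z - min y (k - (a + p)) + min x (k - (a + p + y)))
        (w - min x (k - (a + p + y)) + min (r + y) (k - (a + p + y + x))) := by
  induction k with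
  | zero => simp
  | succ k ih =>
    rw [Function.iterate_succ_apply', ih]
    by_cases h₁ : k < a
    · rw [show a - k = (a - (k + 1)) + 1 by omega, suc_mixed_a]
      congr 1 <;> omega
    by_cases h₂ : k < a + p
    · rw [show a - k = 0 by omega, show p - (k - a) = (p - (k + 1 - a)) + 1 by omega,
        show r + min y (k - (a + p)) - (k - (a + p + y + x)) = 0 by omega, suc_mixed_p]
      congr 1 <;> omega
    by_cases h₃ : k < a + p + y
    · rw [show a - k = 0 by omega, show p - (k - a) = 0 by omega,
        show y - (k - (a + p)) = (y - (k + 1 - (a + p))) + 1 by omega,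
        show z - min y (k - (a + p)) + min x (k - (a + p + y)) =
          (z - min y (k + 1 - (a + p)) + min x (k + 1 - (a + p + y))) + 1 by omega, suc_mixed_y]
      congr 1 <;> omega
    by_cases h₄ : k < a + p + y + x
    · rw [show a - k = 0 by omega, show p - (k - a) = 0 by omega,
        show y - (k - (a + p)) = 0 by omega,
        show x - (k - (a + p + y)) = (x - (k + 1 - (a + p + y))) + 1 by omega,
        show w - min x (k - (a + p + y)) + min (r + y) (k - (a + p + y + x)) =
          (w - min x (k + 1 - (a + p + y)) + min (r + y) (k + 1 - (a + p + y + x))) + 1 by omega,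
        suc_mixed_x]
      congr 1 <;> omega
    rw [show a - k = 0 by omega, show p - (k - a) = 0 by omega,
      show y - (k - (a + p)) = 0 by omega, show x - (k - (a + p + y)) = 0 by omega]
    by_cases h₅ : k < a + p + y + x + (r + y)
    · rw [show r + min y (k - (a + p)) - (k - (a + p + y + x)) =
        (r + min y (k + 1 - (a + p)) - (k + 1 - (a + p + y + x))) + 1 by omega, suc_mixed_r]
      congr 1 <;> omega
    · rw [show r + min y (k - (a + p)) - (k - (a + p + y + x)) = 0 by omega, suc_mixed_fixed]
      congr 1 <;> omega

lemma hasCell_replicate_append (m : ℕ) (c : List ℕ) (t : List (List ℕ)) (i j : ℕ) :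
    HasCell (List.replicate m c ++ t) i j ↔
      (j < m ∧ i < c.length) ∨ (m ≤ j ∧ HasCell t i (j - m)) := by
  unfold HasCell
  rcases lt_or_ge j m with h | h
  · simp [List.getD_eq_getElem?_getD, List.getElem?_append, h, h.not_ge]
  · simp [List.getD_eq_getElem?_getD, List.getElem?_append, h, h.not_gt]

lemma hasCell_mixed {a x y p r z w : ℕ} (hpr : p = 0 ∨ r = 0) (i j : ℕ) :
    HasCell (mixed a x y p r z w) i j ↔
      (i = 0 ∧ j < a + x + y + p + r + z + w) ∨ (i = 1 ∧ j < a + x + y + p + r + z) ∨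
        (i = 2 ∧ j < a + x + y + r) ∨ (i = 3 ∧ j < a) := by
  have h : HasCell (List.replicate w [2]) i (j - a - x - y - p - r - z) ↔
      j - a - x - y - p - r - z < w ∧ i < 1 := by
    have := hasCell_replicate_append w [2] [] i (j - a - x - y - p - r - z)
    simpa [HasCell] using this
  simp only [mixed, hasCell_replicate_append, h, List.length_cons, List.length_nil]
  omega

lemma sum_length_mixed (a x y p r z w : ℕ) :
    ((mixed a x y p r z w).map List.length).sum =
      4 * a + 3 * x + 3 * y + 2 * p + 3 * r + 2 * z + w := by
  simp [mixed]
  ring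

/-- The iteration that defines `P^{AII}` reaches the stationary tableau. -/
lemma PAII_mixed {a x y p r z w : ℕ} (hx : x ≤ w) (hy : y ≤ z) (hpr : p = 0 ∨ r = 0) :
    PAII (mixed a x y p r z w) = mixed 0 0 0 0 0 (z - y + x) (w - x + (r + y)) := by
  rw [PAII, iterate_suc_mixed hx hy hpr, sum_length_mixed]
  congr 1 <;> omega

/-! ### The shape of Littlewood-Richardson-Sundaram tableaux for `n = 2` -/

lemma rowLen_eq_zero {lam : YoungDiagram} {m i : ℕ} (h : lam.colLen 0 ≤ m) (hi : m ≤ i) :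
    lam.rowLen i = 0 := by
  by_contra hne
  have h₁ : (i, 0) ∈ lam := YoungDiagram.mem_iff_lt_rowLen.2 (by omega)
  have := YoungDiagram.mem_iff_lt_colLen.1 h₁
  omega

/-- Cells of a diagram with at most four rows are counted row by row; here the cells in question form
an interval in each row. -/
lemma card_filter_cells {lam : YoungDiagram} (hlam : lam.colLen 0 ≤ 4) (f : ℕ × ℕ → Prop)
    [DecidablePred f] {l₀ u₀ l₁ u₁ l₂ u₂ l₃ u₃ : ℕ}
    (h₀ : ∀ j, (j < lam.rowLen 0 ∧ f (0, j)) ↔ (l₀ ≤ j ∧ j < u₀))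
    (h₁ : ∀ j, (j < lam.rowLen 1 ∧ f (1, j)) ↔ (l₁ ≤ j ∧ j < u₁))
    (h₂ : ∀ j, (j < lam.rowLen 2 ∧ f (2, j)) ↔ (l₂ ≤ j ∧ j < u₂))
    (h₃ : ∀ j, (j < lam.rowLen 3 ∧ f (3, j)) ↔ (l₃ ≤ j ∧ j < u₃)) :
    (lam.cells.filter f).card = (u₀ - l₀) + (u₁ - l₁) + (u₂ - l₂) + (u₃ - l₃) := by
  have hrow : ∀ i l u, (∀ j, (j < lam.rowLen i ∧ f (i, j)) ↔ (l ≤ j ∧ j < u)) →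
      ((lam.cells.filter f).filter fun c => c.1 = i).card = u - l := by
    intro i l u h
    have : (lam.cells.filter f).filter (fun c => c.1 = i) =
        (Finset.Ico l u).map ⟨fun j => (i, j), fun a b hab => by simpa using hab⟩ := by
      ext ⟨i', j⟩
      simp only [Finset.mem_filter, YoungDiagram.mem_cells, Finset.mem_map, Finset.mem_Ico,
        YoungDiagram.mem_iff_lt_rowLen]
      constructor
      · rintro ⟨h', rfl⟩
        exact ⟨j, (h j).1 h', rfl⟩
      · rintro ⟨j', h', e⟩
        obtain ⟨rfl, rfl⟩ := Prod.mk.inj e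
        exact ⟨(h j').2 h', rfl⟩
    rw [this, Finset.card_map, Nat.card_Ico]
  have hmap : ∀ c ∈ lam.cells.filter f, c.1 ∈ Finset.range 4 := by
    rintro ⟨i, j⟩ hc
    have hc' := (Finset.mem_filter.1 hc).1
    rw [YoungDiagram.mem_cells, YoungDiagram.mem_iff_lt_rowLen] at hc'
    by_contra hi
    rw [rowLen_eq_zero hlam (by simpa using hi)] at hc'
    omega
  rw [Finset.card_eq_sum_card_fiberwise hmap]
  simp only [Finset.sum_range_succ, Finset.sum_range_zero]
  rw [hrow 0 _ _ h₀, hrow 1 _ _ h₁, hrow 2 _ _ h₂, hrow 3 _ _ h₃, Nat.zero_add]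

lemma exists_threshold (P : ℕ → Prop) {lo hi : ℕ} (hle : lo ≤ hi)
    (h : ∀ i j, lo ≤ i → i < j → j < hi → P j → P i) :
    ∃ A, lo ≤ A ∧ A ≤ hi ∧ ∀ j, lo ≤ j → j < hi → (P j ↔ j < A) := by
  induction hi, hle using Nat.le_induction with
  | base => exact ⟨lo, le_rfl, le_rfl, fun j h₁ h₂ => by omega⟩
  | succ hi hle ih =>
    by_cases hP : P hi
    · refine ⟨hi + 1, by omega, le_rfl, fun j h₁ h₂ => ⟨fun _ => h₂, fun _ => ?_⟩⟩
      rcases (Nat.lt_succ_iff.1 h₂).lt_or_eq with h₃ | rfl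
      · exact h j hi h₁ h₃ (by omega) hP
      · exact hP
    · obtain ⟨A, h₁, h₂, h₃⟩ := ih fun i j h₁ h₂ h₃ => h i j h₁ h₂ (by omega)
      refine ⟨A, h₁, by omega, fun j h₄ h₅ => ?_⟩
      rcases (Nat.lt_succ_iff.1 h₅).lt_or_eq with h₆ | rfl
      · exact h₃ j h₄ h₆
      · exact ⟨fun h => absurd h hP, fun h => by omega⟩

/-- The Yamanouchi condition bounds the entries by the row number. -/
lemma IsLRS.le_row {n : ℕ} {lam mu : YoungDiagram} {T : ℕ → ℕ → ℕ} (h : IsLRS n lam mu T) :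
    ∀ i j, (i, j) ∈ lam → T i j ≤ i + 1 := by
  intro i
  induction i using Nat.strong_induction_on with
  | _ i ih =>
    intro j hj
    rw [YoungDiagram.mem_iff_lt_rowLen] at hj
    set J := lam.rowLen i - 1 with hJ
    have hJm : (i, J) ∈ lam := YoungDiagram.mem_iff_lt_rowLen.2 (by omega)
    have hle : T i j ≤ T i J := by
      rcases (show j ≤ J by omega).lt_or_eq with h' | rfl
      · exact h.skew.row_weak i j J h' hJm
      · rfl
    refine hle.trans ?_
    by_contra hlt
    -- The last cell of the row would be preceded by no entry `T i J - 1`.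
    have hy := h.yamanouchi (i, J) (by simpa using hJm) (T i J - 1) (by omega)
    rw [show T i J - 1 + 1 = T i J by omega] at hy
    have hpos : 0 < occ (readUpTo lam (i, J)) T (T i J) :=
      Finset.card_pos.2 ⟨(i, J), by simp [readUpTo, hJm]⟩
    obtain ⟨⟨i', j'⟩, hd⟩ := Finset.card_pos.1 (hpos.trans_le hy)
    simp only [readUpTo, Finset.mem_filter, YoungDiagram.mem_cells] at hd
    obtain ⟨⟨hd₁, hd₂⟩, hd₃⟩ := hd
    rcases lt_trichotomy i' i with h' | rfl | h'
    · have := ih i' h' j' hd₁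
      omega
    · rw [YoungDiagram.mem_iff_lt_rowLen] at hd₁
      obtain rfl : j' = J := by omega
      omega
    · have := YoungDiagram.mem_iff_lt_rowLen.1 (lam.up_left_mem h'.le le_rfl hd₁)
      omega

/-- The structure of a recording tableau in `Rec_4(lam / mu)`: for the underlying tableau, `p` and
`q` are the numbers of entries `1` in the first and the second row, `s` and `e` are the numbers of
entries `2` in the second and the third row, and `b` is the number of entries `3`, all in the third
row, and of entries `4`, all in the fourth row. -/
structure IsRecording (lam mu : YoungDiagram) (Q : ℕ → ℕ → ℕ) (p q s e b : ℕ) : Prop where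
  lam₀ : lam.rowLen 0 = mu.rowLen 0 + p
  lam₁ : lam.rowLen 1 = mu.rowLen 1 + q + s
  lam₂ : lam.rowLen 2 = e + b
  lam₃ : lam.rowLen 3 = b
  lam₄ : ∀ i, 4 ≤ i → lam.rowLen i = 0
  mu₂ : ∀ i, 2 ≤ i → mu.rowLen i = 0
  ones_le : mu.rowLen 1 + q ≤ mu.rowLen 0
  twos_le : e ≤ mu.rowLen 1 + q
  weight : p + q = s + e
  b_le : b ≤ s
  s_le : s ≤ p
  row₀ : ∀ j, Q 0 j = if j < mu.rowLen 0 then 0 else lam.rowLen 0 - j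
  row₁ : ∀ j, Q 1 j = if j < mu.rowLen 1 then 0 else
    if j < mu.rowLen 1 + q then p + (mu.rowLen 1 + q - j) else lam.rowLen 1 - j
  row₂ : ∀ j, Q 2 j = if j < e then s + (e - j) else lam.rowLen 2 - j
  row₃ : ∀ j, Q 3 j = lam.rowLen 3 - j
  row₄ : ∀ i j, 4 ≤ i → Q i j = 0

/-- The Littlewood-Richardson-Sundaram tableau is determined by the two shapes: the first row
has entries `1`, the second row `1` and `2`, the third row `2` and `3`, the fourth row `4`. -/
lemma IsLRS.isRecording {lam mu : YoungDiagram} {T : ℕ → ℕ → ℕ} (h : IsLRS 2 lam mu T)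
    (hlam : lam.colLen 0 ≤ 4) (hmu : mu.colLen 0 ≤ 2) (hsub : mu ≤ lam) :
    ∃ p q s e b, IsRecording lam mu (lozenge lam T) p q s e b := by
  have hmu2 : ∀ i, 2 ≤ i → mu.rowLen i = 0 := fun i hi => rowLen_eq_zero hmu hi
  have hlam4 : ∀ i, 4 ≤ i → lam.rowLen i = 0 := fun i hi => rowLen_eq_zero hlam hi
  have hml : ∀ i, mu.rowLen i ≤ lam.rowLen i := by
    intro i
    by_contra hlt
    have h₁ : (i, lam.rowLen i) ∈ mu := YoungDiagram.mem_iff_lt_rowLen.2 (by omega)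
    have h₂ : (i, lam.rowLen i) ∈ lam := hsub h₁
    rw [YoungDiagram.mem_iff_lt_rowLen] at h₂
    omega
  have hrange : ∀ i j, mu.rowLen i ≤ j → j < lam.rowLen i → 1 ≤ T i j ∧ T i j ≤ i + 1 := by
    intro i j h₁ h₂
    have h₃ : (i, j) ∈ lam := YoungDiagram.mem_iff_lt_rowLen.2 h₂
    exact ⟨(h.skew.range i j h₃ fun h₄ => by
      rw [YoungDiagram.mem_iff_lt_rowLen] at h₄; omega).1, h.le_row i j h₃⟩
  have hin : ∀ i j, j < mu.rowLen i → T i j = 0 := fun i j hj =>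
    h.skew.zero_inner i j (YoungDiagram.mem_iff_lt_rowLen.2 hj)
  have hout : ∀ i j, lam.rowLen i ≤ j → T i j = 0 := fun i j hj =>
    h.skew.zero_outside i j fun h' => by rw [YoungDiagram.mem_iff_lt_rowLen] at h'; omega
  have hweak : ∀ i j₁ j₂, j₁ < j₂ → j₂ < lam.rowLen i → T i j₁ ≤ T i j₂ := fun i j₁ j₂ h₁ h₂ =>
    h.skew.row_weak i j₁ j₂ h₁ (YoungDiagram.mem_iff_lt_rowLen.2 h₂)
  have hstrict : ∀ i j, mu.rowLen i ≤ j → j < lam.rowLen (i + 1) → T i j < T (i + 1) j :=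
    fun i j h₁ h₂ => h.skew.col_strict i (i + 1) j (by omega)
      (fun h' => by rw [YoungDiagram.mem_iff_lt_rowLen] at h'; omega)
      (YoungDiagram.mem_iff_lt_rowLen.2 h₂)
  have hsund : ∀ i, 1 ≤ i → 0 < lam.rowLen (2 + i - 1) → 2 * i ≤ T (2 + i - 1) 0 := fun i h₁ h₂ =>
    h.sundaram i h₁ (YoungDiagram.mem_iff_lt_rowLen.2 h₂)
  have anti : ∀ i, lam.rowLen (i + 1) ≤ lam.rowLen i := fun i => lam.rowLen_anti i (i + 1) (by omega)
  have anti' : mu.rowLen 1 ≤ mu.rowLen 0 := mu.rowLen_anti 0 1 (by omega)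
  have a₀ := anti 0
  have a₁ := anti 1
  have a₂ := anti 2
  have hml0 := hml 0
  have hml1 := hml 1
  have hmu2' := hmu2 2 le_rfl
  have hmu3' := hmu2 3 (by omega)
  simp only [Nat.zero_add, Nat.reduceAdd] at a₀ a₁ a₂
  obtain ⟨A, hA₁, hA₂, hA⟩ := exists_threshold (fun j => T 1 j = 1) hml1 (by
    intro i j h₁ h₂ h₃ h₄
    have := hweak 1 i j h₂ h₃
    have := hrange 1 i h₁ (by omega)
    omega)
  obtain ⟨e, -, he₂, he⟩ := exists_threshold (fun j => T 2 j = 2) (Nat.zero_le (lam.rowLen 2)) (by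
    intro i j h₁ h₂ h₃ h₄
    have := hweak 2 i j h₂ h₃
    have h₅ := hsund 1 le_rfl (by simpa using by omega)
    simp only [Nat.reduceAdd, Nat.add_one_sub_one, Nat.reduceMul] at h₅
    rcases Nat.eq_zero_or_pos i with rfl | hi
    · omega
    · have := hweak 2 0 i hi (by omega)
      omega)
  have T0 : ∀ j, T 0 j = if j < mu.rowLen 0 then 0 else if j < lam.rowLen 0 then 1 else 0 := by
    intro j
    split_ifs with h₁ h₂
    · exact hin 0 j h₁
    · have := hrange 0 j (by omega) h₂
      omega
    · exact hout 0 j (by omega)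
  have T1 : ∀ j, T 1 j = if j < mu.rowLen 1 then 0 else if j < A then 1 else
      if j < lam.rowLen 1 then 2 else 0 := by
    intro j
    split_ifs with h₁ h₂ h₃
    · exact hin 1 j h₁
    · exact (hA j (by omega) (by omega)).2 h₂
    · have := hrange 1 j (by omega) h₃
      have := (hA j (by omega) h₃).not.2 h₂
      omega
    · exact hout 1 j (by omega)
  have T2 : ∀ j, T 2 j = if j < e then 2 else if j < lam.rowLen 2 then 3 else 0 := by
    intro j
    split_ifs with h₁ h₂
    · exact (he j (by omega) (by omega)).2 h₁
    · have h₅ := hsund 1 le_rfl (by simpa using by omega)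
      simp only [Nat.reduceAdd, Nat.add_one_sub_one, Nat.reduceMul] at h₅
      have := hrange 2 j (by omega) h₂
      have := (he j (by omega) h₂).not.2 h₁
      rcases Nat.eq_zero_or_pos j with rfl | hj
      · omega
      · have := hweak 2 0 j hj h₂
        omega
    · exact hout 2 j (by omega)
  have T3 : ∀ j, T 3 j = if j < lam.rowLen 3 then 4 else 0 := by
    intro j
    split_ifs with h₁
    · have h₅ := hsund 2 (by omega) (by simpa using by omega)
      simp only [Nat.reduceAdd, Nat.add_one_sub_one, Nat.reduceMul] at h₅
      have := hrange 3 j (by omega) h₁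
      rcases Nat.eq_zero_or_pos j with rfl | hj
      · omega
      · have := hweak 3 0 j hj h₁
        omega
    · exact hout 3 j (by omega)
  have hAm : A ≤ mu.rowLen 0 := by
    by_contra hlt
    have h₁ := hstrict 0 (A - 1) (by omega) (by simp only [Nat.zero_add]; omega)
    simp only [Nat.zero_add, T0, T1] at h₁
    split_ifs at h₁ <;> omega
  have heA : e ≤ A := by
    by_contra hlt
    have h₁ := hstrict 1 (e - 1) (by omega) (by simp only [Nat.reduceAdd]; omega)
    simp only [Nat.reduceAdd, T2, T1] at h₁
    split_ifs at h₁ <;> omega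
  -- The conditions on the weight.
  have w₁ : occ lam.cells T 1 = (lam.rowLen 0 - mu.rowLen 0) + (A - mu.rowLen 1) + (0 - 0) +
      (0 - 0) := by
    refine card_filter_cells hlam _ ?_ ?_ ?_ ?_ <;> intro j <;> simp only [T0, T1, T2, T3] <;>
        split_ifs <;> (try simp only [and_false, and_true, false_iff]) <;>
        omega
  have w₂ : occ lam.cells T 2 = (0 - 0) + (lam.rowLen 1 - A) + (e - 0) + (0 - 0) := by
    refine card_filter_cells hlam _ ?_ ?_ ?_ ?_ <;> intro j <;> simp only [T0, T1, T2, T3] <;>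
        split_ifs <;> (try simp only [and_false, and_true, false_iff]) <;>
        omega
  have w₃ : occ lam.cells T 3 = (0 - 0) + (0 - 0) + (lam.rowLen 2 - e) + (0 - 0) := by
    refine card_filter_cells hlam _ ?_ ?_ ?_ ?_ <;> intro j <;> simp only [T0, T1, T2, T3] <;>
        split_ifs <;> (try simp only [and_false, and_true, false_iff]) <;>
        omega
  have w₄ : occ lam.cells T 4 = (0 - 0) + (0 - 0) + (0 - 0) + (lam.rowLen 3 - 0) := by
    refine card_filter_cells hlam _ ?_ ?_ ?_ ?_ <;> intro j <;> simp only [T0, T1, T2, T3] <;>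
        split_ifs <;> (try simp only [and_false, and_true, false_iff]) <;>
        omega
  have e₁ := h.weight_even 1 le_rfl
  have e₂ := h.weight_even 2 (by omega)
  simp only [Nat.mul_one, Nat.reduceMul, Nat.reduceSub, w₁, w₂, w₃, w₄] at e₁ e₂
  -- The Yamanouchi condition at the leftmost `2` of the second row.
  have hs : lam.rowLen 1 - A ≤ lam.rowLen 0 - mu.rowLen 0 := by
    by_cases hlt : A < lam.rowLen 1
    · have hy := h.yamanouchi (1, A) (by
        simpa using YoungDiagram.mem_iff_lt_rowLen.2 hlt) 1 le_rfl
      have o₂ : occ (readUpTo lam (1, A)) T 2 = (0 - 0) + (lam.rowLen 1 - A) + (0 - 0) +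
          (0 - 0) := by
        rw [occ, readUpTo, Finset.filter_filter]
        refine card_filter_cells hlam _ ?_ ?_ ?_ ?_ <;> intro j <;> simp only [T0, T1, T2, T3] <;>
        split_ifs <;> (try simp only [and_false, and_true, false_iff]) <;>
        omega
      have o₁ : occ (readUpTo lam (1, A)) T 1 = (lam.rowLen 0 - mu.rowLen 0) + (0 - 0) + (0 - 0) +
          (0 - 0) := by
        rw [occ, readUpTo, Finset.filter_filter]
        refine card_filter_cells hlam _ ?_ ?_ ?_ ?_ <;> intro j <;> simp only [T0, T1, T2, T3] <;>
        split_ifs <;> (try simp only [and_false, and_true, false_iff]) <;>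
        omega
      rw [show (1 + 1 : ℕ) = 2 from rfl, o₁, o₂] at hy
      omega
    · omega
  -- The Yamanouchi condition at the leftmost `3` of the third row.
  have hb : lam.rowLen 2 - e ≤ lam.rowLen 1 - A := by
    by_cases hlt : e < lam.rowLen 2
    · have hy := h.yamanouchi (2, e) (by
        simpa using YoungDiagram.mem_iff_lt_rowLen.2 hlt) 2 (by omega)
      have o₃ : occ (readUpTo lam (2, e)) T 3 = (0 - 0) + (0 - 0) + (lam.rowLen 2 - e) +
          (0 - 0) := by
        rw [occ, readUpTo, Finset.filter_filter]
        refine card_filter_cells hlam _ ?_ ?_ ?_ ?_ <;> intro j <;> simp only [T0, T1, T2, T3] <;>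
        split_ifs <;> (try simp only [and_false, and_true, false_iff]) <;>
        omega
      have o₂ : occ (readUpTo lam (2, e)) T 2 = (0 - 0) + (lam.rowLen 1 - A) + (0 - 0) +
          (0 - 0) := by
        rw [occ, readUpTo, Finset.filter_filter]
        refine card_filter_cells hlam _ ?_ ?_ ?_ ?_ <;> intro j <;> simp only [T0, T1, T2, T3] <;>
        split_ifs <;> (try simp only [and_false, and_true, false_iff]) <;>
        omega
      rw [show (2 + 1 : ℕ) = 3 from rfl, o₂, o₃] at hy
      omega
    · omega
  refine ⟨lam.rowLen 0 - mu.rowLen 0, A - mu.rowLen 1, lam.rowLen 1 - A, e, lam.rowLen 3,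
    by omega, by omega, by omega, rfl, hlam4, hmu2, by omega, by omega, by omega, by omega,
    by omega, ?_, ?_, ?_, ?_, ?_⟩
  · intro j
    rw [lozenge, T0]
    by_cases c₁ : j < mu.rowLen 0
    · simp [c₁]
    by_cases c₂ : j < lam.rowLen 0
    · rw [if_neg c₁, if_pos c₂, if_neg one_ne_zero, if_neg c₁]
      refine (card_filter_cells (l₀ := j) (u₀ := lam.rowLen 0) (l₁ := 0) (u₁ := 0)
        (l₂ := 0) (u₂ := 0) (l₃ := 0) (u₃ := 0) hlam _ ?_ ?_ ?_ ?_).trans (by omega) <;> intro j <;>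
        simp only [T0, T1, T2, T3] <;>
        split_ifs <;> (try simp only [and_false, false_and, true_and, false_iff]) <;>
        omega
    · rw [if_neg c₁, if_neg c₂, if_pos rfl, if_neg c₁]
      omega
  · intro j
    rw [lozenge, T1]
    by_cases c₁ : j < mu.rowLen 1
    · simp [c₁]
    by_cases c₂ : j < A
    · rw [if_neg c₁, if_pos c₂, if_neg one_ne_zero, if_neg c₁, if_pos (by omega)]
      refine (card_filter_cells (l₀ := mu.rowLen 0) (u₀ := lam.rowLen 0) (l₁ := j) (u₁ := A)
        (l₂ := 0) (u₂ := 0) (l₃ := 0) (u₃ := 0) hlam _ ?_ ?_ ?_ ?_).trans (by omega) <;> intro j <;>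
        simp only [T0, T1, T2, T3] <;>
        split_ifs <;> (try simp only [and_false, false_and, true_and, false_iff]) <;>
        omega
    by_cases c₃ : j < lam.rowLen 1
    · rw [if_neg c₁, if_neg c₂, if_pos c₃, if_neg two_ne_zero, if_neg c₁, if_neg (by omega)]
      refine (card_filter_cells (l₀ := 0) (u₀ := 0) (l₁ := j) (u₁ := lam.rowLen 1)
        (l₂ := 0) (u₂ := 0) (l₃ := 0) (u₃ := 0) hlam _ ?_ ?_ ?_ ?_).trans (by omega) <;> intro j <;>
        simp only [T0, T1, T2, T3] <;>
        split_ifs <;> (try simp only [and_false, false_and, true_and, false_iff]) <;>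
        omega
    · rw [if_neg c₁, if_neg c₂, if_neg c₃, if_pos rfl]
      split_ifs <;> omega
  · intro j
    rw [lozenge, T2]
    by_cases c₂ : j < e
    · rw [if_pos c₂, if_neg two_ne_zero, if_pos c₂]
      refine (card_filter_cells (l₀ := 0) (u₀ := 0) (l₁ := A) (u₁ := lam.rowLen 1)
        (l₂ := j) (u₂ := e) (l₃ := 0) (u₃ := 0) hlam _ ?_ ?_ ?_ ?_).trans (by omega) <;> intro j <;>
        simp only [T0, T1, T2, T3] <;>
        split_ifs <;> (try simp only [and_false, false_and, true_and, false_iff]) <;>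
        omega
    by_cases c₃ : j < lam.rowLen 2
    · rw [if_neg c₂, if_pos c₃, if_neg three_ne_zero, if_neg c₂]
      refine (card_filter_cells (l₀ := 0) (u₀ := 0) (l₁ := 0) (u₁ := 0)
        (l₂ := j) (u₂ := lam.rowLen 2) (l₃ := 0) (u₃ := 0) hlam _ ?_ ?_ ?_ ?_).trans (by omega) <;>
        intro j <;> simp only [T0, T1, T2, T3] <;>
        split_ifs <;> (try simp only [and_false, false_and, true_and, false_iff]) <;>
        omega
    · rw [if_neg c₂, if_neg c₃, if_pos rfl, if_neg c₂]
      omega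
  · intro j
    rw [lozenge, T3]
    by_cases c₃ : j < lam.rowLen 3
    · rw [if_pos c₃, if_neg four_ne_zero]
      refine (card_filter_cells (l₀ := 0) (u₀ := 0) (l₁ := 0) (u₁ := 0)
        (l₂ := 0) (u₂ := 0) (l₃ := j) (u₃ := lam.rowLen 3) hlam _ ?_ ?_ ?_ ?_).trans (by omega) <;>
        intro j <;> simp only [T0, T1, T2, T3] <;>
        split_ifs <;> (try simp only [and_false, false_and, true_and, false_iff]) <;>
        omega
    · rw [if_neg c₃, if_pos rfl]
      omega
  · intro i j hi
    rw [lozenge, hout i j (by rw [hlam4 i hi]; omega), if_pos rfl]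

/-! ### The slacks of a recording tableau -/

/-- The length of the row of index `i` of the partition `μ^{(k)}`, for a recording tableau with the
parameters `p, q, s, e, b`. The `k`-th vertical strip lies in all four rows for `k ≤ b`, in the
first and second row for `b < k ≤ s`, in the first and third row for `s < k ≤ p`, and in the
second and third row for `p < k ≤ p + q`. -/
def nestedRow (mu : YoungDiagram) (p q s e b k : ℕ) : ℕ → ℕ
  | 0 => mu.rowLen 0 + (p - k)
  | 1 => mu.rowLen 1 + (s - k) + min q (p + q - k)
  | 2 => (b - k) + min e (s + e - k)
  | 3 => b - k
  | _ => 0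

namespace IsRecording

variable {lam mu : YoungDiagram} {Q : ℕ → ℕ → ℕ} {p q s e b : ℕ}

lemma lt_nestedRow_iff (h : IsRecording lam mu Q p q s e b) (i j k : ℕ) :
    j < nestedRow mu p q s e b k i ↔ (i, j) ∈ mu ∨ k < Q i j := by
  obtain ⟨l₀, l₁, l₂, l₃, l₄, m₂, h₁, h₂, h₃, h₄, h₅, r₀, r₁, r₂, r₃, r₄⟩ := h
  rw [YoungDiagram.mem_iff_lt_rowLen]
  match i with
  | 0 => simp only [nestedRow, r₀]; split_ifs <;> omega
  | 1 => simp only [nestedRow, r₁]; split_ifs <;> omega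
  | 2 => simp only [nestedRow, r₂, m₂ 2 le_rfl]; split_ifs <;> omega
  | 3 => simp only [nestedRow, r₃, m₂ 3 (by omega)]; omega
  | i + 4 => simp [nestedRow, r₄ (i + 4) j (by omega), m₂ (i + 4) (by omega)]

lemma eq_zero_of_mem (h : IsRecording lam mu Q p q s e b) {i j : ℕ} (hm : (i, j) ∈ mu) :
    Q i j = 0 := by
  obtain ⟨l₀, l₁, l₂, l₃, l₄, m₂, h₁, h₂, h₃, h₄, h₅, r₀, r₁, r₂, r₃, r₄⟩ := h
  rw [YoungDiagram.mem_iff_lt_rowLen] at hm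
  match i with
  | 0 => simp [r₀, hm]
  | 1 => simp [r₁, hm]
  | i + 2 => simp [m₂ (i + 2) (by omega)] at hm

lemma mem_of_pos (h : IsRecording lam mu Q p q s e b) {i j : ℕ} (hQ : 0 < Q i j) :
    (i, j) ∈ lam := by
  obtain ⟨l₀, l₁, l₂, l₃, l₄, m₂, h₁, h₂, h₃, h₄, h₅, r₀, r₁, r₂, r₃, r₄⟩ := h
  rw [YoungDiagram.mem_iff_lt_rowLen]
  match i with
  | 0 => simp only [r₀] at hQ; split_ifs at hQ <;> omega
  | 1 => simp only [r₁] at hQ; split_ifs at hQ <;> omega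
  | 2 => simp only [r₂] at hQ; split_ifs at hQ <;> omega
  | 3 => simp only [r₃] at hQ; omega
  | i + 4 => simp [r₄ (i + 4) j (by omega)] at hQ

lemma le_weight (h : IsRecording lam mu Q p q s e b) (i j : ℕ) : Q i j ≤ p + q := by
  obtain ⟨l₀, l₁, l₂, l₃, l₄, m₂, h₁, h₂, h₃, h₄, h₅, r₀, r₁, r₂, r₃, r₄⟩ := h
  match i with
  | 0 => simp only [r₀]; split_ifs <;> omega
  | 1 => simp only [r₁]; split_ifs <;> omega
  | 2 => simp only [r₂]; split_ifs <;> omega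
  | 3 => simp only [r₃]; omega
  | i + 4 => simp [r₄ (i + 4) j (by omega)]

lemma mem_nested_iff (h : IsRecording lam mu Q p q s e b) (i j k : ℕ) :
    (i, j) ∈ nested lam mu Q k ↔ j < nestedRow mu p q s e b k i := by
  rw [h.lt_nestedRow_iff, nested, Finset.mem_union, Finset.mem_filter, YoungDiagram.mem_cells,
    YoungDiagram.mem_cells, Nat.succ_le_iff]
  exact or_congr_right ⟨fun h' => h'.2, fun h' => ⟨h.mem_of_pos (by omega), h'⟩⟩

lemma numStrips_eq (h : IsRecording lam mu Q p q s e b) : numStrips lam Q = p + q := by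
  refine le_antisymm (Finset.sup_le fun c _ => h.le_weight c.1 c.2) ?_
  have key : ∀ i j, Q i j ≤ numStrips lam Q := by
    intro i j
    rcases Nat.eq_zero_or_pos (Q i j) with h' | h'
    · omega
    · exact Finset.le_sup (f := fun c : ℕ × ℕ => Q c.1 c.2) (b := (i, j))
        ((YoungDiagram.mem_cells _).2 (h.mem_of_pos h'))
  -- The largest entry is at the left end of the ones of the underlying tableau.
  rcases Nat.eq_zero_or_pos q with hq | hq
  · have := key 0 (mu.rowLen 0)
    rw [h.row₀, if_neg (lt_irrefl _), h.lam₀] at this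
    omega
  · have := key 1 (mu.rowLen 1)
    rw [h.row₁, if_neg (lt_irrefl _), if_pos (by omega)] at this
    omega

/-- The `k`-th vertical strip, if it lies in the rows with index in `S`. -/
lemma strip_eq (h : IsRecording lam mu Q p q s e b) {k : ℕ} {S : Finset ℕ}
    (hS : ∀ i, nestedRow mu p q s e b (k - 1) i =
      nestedRow mu p q s e b k i + if i ∈ S then 1 else 0) :
    nested lam mu Q (k - 1) \ nested lam mu Q k =
      S.map ⟨fun i => (i, nestedRow mu p q s e b k i), fun _ _ h' => (Prod.mk.inj h').1⟩ := by
  ext ⟨i, j⟩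
  rw [Finset.mem_sdiff, h.mem_nested_iff, h.mem_nested_iff, hS, Finset.mem_map]
  constructor
  · rintro ⟨h₁, h₂⟩
    split_ifs at h₁ with h₃
    · exact ⟨i, h₃, Prod.ext rfl (show nestedRow mu p q s e b k i = j by omega)⟩
    · omega
  · rintro ⟨i', h₁, h₂⟩
    obtain ⟨rfl, rfl⟩ := Prod.mk.inj h₂
    rw [if_pos h₁]
    omega

lemma stripRows_eq (h : IsRecording lam mu Q p q s e b) {k : ℕ} {S : Finset ℕ}
    (hS : ∀ i, nestedRow mu p q s e b (k - 1) i =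
      nestedRow mu p q s e b k i + if i ∈ S then 1 else 0) :
    stripRows lam mu Q k = S.image (· + 1) := by
  ext i
  rw [stripRows, h.strip_eq hS, Finset.mem_image, Finset.mem_image]
  simp only [Finset.mem_map, exists_exists_and_eq_and]
  rfl

lemma slack_eq (h : IsRecording lam mu Q p q s e b) {k : ℕ} {S : Finset ℕ}
    (hS : ∀ i, nestedRow mu p q s e b (k - 1) i =
      nestedRow mu p q s e b k i + if i ∈ S then 1 else 0) :
    slack lam mu Q k = (nestedLength lam mu Q k : ℤ) -
      (S.filter fun i => i + 1 ≤ nestedLength lam mu Q k).card := by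
  rw [slack, h.strip_eq hS, Finset.filter_map, Finset.card_map]
  rfl

lemma occ_eq (h : IsRecording lam mu Q p q s e b) {k : ℕ} {S : Finset ℕ} (hk : 1 ≤ k)
    (hS : ∀ i, nestedRow mu p q s e b (k - 1) i =
      nestedRow mu p q s e b k i + if i ∈ S then 1 else 0) :
    occ lam.cells Q k = S.card := by
  have : lam.cells.filter (fun c => Q c.1 c.2 = k) =
      nested lam mu Q (k - 1) \ nested lam mu Q k := by
    ext ⟨i, j⟩
    rw [Finset.mem_sdiff, h.mem_nested_iff, h.mem_nested_iff, h.lt_nestedRow_iff,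
      h.lt_nestedRow_iff, Finset.mem_filter, YoungDiagram.mem_cells]
    constructor
    · rintro ⟨h₁, h₂⟩
      simp only at h₂
      refine ⟨Or.inr (by omega), ?_⟩
      rintro (h₃ | h₃)
      · have := h.eq_zero_of_mem h₃
        omega
      · omega
    · rintro ⟨h₁, h₂⟩
      rw [not_or] at h₂
      have h₃ := h₁.resolve_left h₂.1
      have h₄ := h₂.2
      exact ⟨h.mem_of_pos (by omega), show Q i j = k by omega⟩
  rw [occ, this, h.strip_eq hS, Finset.card_map]

lemma nestedRow_pos_iff (h : IsRecording lam mu Q p q s e b) (k i : ℕ) :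
    0 < nestedRow mu p q s e b k i ↔ i < nestedLength lam mu Q k := by
  obtain ⟨l, hl⟩ : ∃ l, ∀ i, 0 < nestedRow mu p q s e b k i ↔ i < l := by
    obtain ⟨l₀, l₁, l₂, l₃, l₄, m₂, h₁, h₂, h₃, h₄, h₅, r₀, r₁, r₂, r₃, r₄⟩ := h
    refine ⟨if k < b then 4 else if 0 < min e (s + e - k) then 3 else
      if 0 < mu.rowLen 1 + (s - k) + min q (p + q - k) then 2 else
      if 0 < mu.rowLen 0 + (p - k) then 1 else 0, fun i => ?_⟩
    match i with
    | 0 => simp only [nestedRow]; split_ifs <;> omega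
    | 1 => simp only [nestedRow]; split_ifs <;> omega
    | 2 => simp only [nestedRow]; split_ifs <;> omega
    | 3 => simp only [nestedRow]; split_ifs <;> omega
    | i + 4 => simp only [nestedRow]; split_ifs <;> omega
  have : (nested lam mu Q k).image Prod.fst = Finset.range l := by
    ext i
    rw [Finset.mem_range, ← hl, Finset.mem_image]
    constructor
    · rintro ⟨⟨i', j⟩, h₁, rfl⟩
      rw [h.mem_nested_iff] at h₁
      simp only
      omega
    · exact fun h₁ => ⟨(i, 0), (h.mem_nested_iff i 0 k).2 h₁, rfl⟩
  rw [hl, nestedLength, this, Finset.card_range]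

/-- Slack vector, slack and size of the `k`-th vertical strip. -/
lemma slack_cases (h : IsRecording lam mu Q p q s e b) {k : ℕ} (hk : 1 ≤ k) (hk' : k ≤ p + q) :
    (k ≤ b ∧ slackVector lam mu Q k = ∅ ∧ slack lam mu Q k = 0 ∧ occ lam.cells Q k = 4) ∨
    (b < k ∧ k ≤ s ∧ e = 0 ∧ slackVector lam mu Q k = ∅ ∧ slack lam mu Q k = 0 ∧
      occ lam.cells Q k = 2) ∨
    (b < k ∧ k ≤ s ∧ 0 < e ∧ slackVector lam mu Q k = {3} ∧ slack lam mu Q k = 1) ∨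
    (s < k ∧ k ≤ p ∧ slackVector lam mu Q k = {2} ∧ slack lam mu Q k = 1) ∨
    (p < k ∧ slackVector lam mu Q k = {1} ∧ slack lam mu Q k = 1) := by
  have hS : ∀ S : Finset ℕ,
      (∀ i, nestedRow mu p q s e b (k - 1) i =
        nestedRow mu p q s e b k i + if i ∈ S then 1 else 0) →
      slackVector lam mu Q k = Finset.Icc 1 (nestedLength lam mu Q k) \ S.image (· + 1) ∧
      slack lam mu Q k = (nestedLength lam mu Q k : ℤ) -
        (S.filter fun i => i + 1 ≤ nestedLength lam mu Q k).card ∧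
      occ lam.cells Q k = S.card := fun S hS =>
    ⟨by rw [slackVector, h.stripRows_eq hS], h.slack_eq hS, h.occ_eq hk hS⟩
  have z₀ := h.nestedRow_pos_iff k 0
  have z₁ := h.nestedRow_pos_iff k 1
  have z₂ := h.nestedRow_pos_iff k 2
  have z₃ := h.nestedRow_pos_iff k 3
  have z₄ := h.nestedRow_pos_iff k 4
  generalize nestedLength lam mu Q k = l at *
  simp only [nestedRow] at z₀ z₁ z₂ z₃ z₄
  have hl : l ≤ 4 := by omega
  obtain ⟨l₀, l₁, l₂, l₃, l₄, m₂, h₁, h₂, h₃, h₄, h₅, r₀, r₁, r₂, r₃, r₄⟩ := h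
  by_cases c₁ : k ≤ b
  · obtain ⟨v, t, o⟩ := hS {0, 1, 2, 3} fun i => by
      match i with
      | 0 => simp [nestedRow]; omega
      | 1 => simp [nestedRow]; omega
      | 2 => simp [nestedRow]; omega
      | 3 => simp [nestedRow]; omega
      | i + 4 => simp [nestedRow]
    refine Or.inl ⟨c₁, ?_, ?_, o⟩
    · rw [v]
      interval_cases l <;> rfl
    · rw [t]
      interval_cases l <;> rfl
  by_cases c₂ : k ≤ s
  · obtain ⟨v, t, o⟩ := hS {0, 1} fun i => by
      match i with
      | 0 => simp [nestedRow]; omega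
      | 1 => simp [nestedRow]; omega
      | 2 => simp [nestedRow]; omega
      | 3 => simp [nestedRow]; omega
      | i + 4 => simp [nestedRow]
    rcases Nat.eq_zero_or_pos e with c₃ | c₃
    · refine Or.inr (Or.inl ⟨by omega, c₂, c₃, ?_, ?_, o⟩)
      · rw [v]
        have : l ≤ 2 := by omega
        interval_cases l <;> rfl
      · rw [t]
        have : l ≤ 2 := by omega
        interval_cases l <;> rfl
    · obtain rfl : l = 3 := by omega
      exact Or.inr (Or.inr (Or.inl ⟨by omega, c₂, c₃, v.trans rfl, t.trans rfl⟩))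
  by_cases c₃ : k ≤ p
  · obtain ⟨v, t, -⟩ := hS {0, 2} fun i => by
      match i with
      | 0 => simp [nestedRow]; omega
      | 1 => simp [nestedRow]; omega
      | 2 => simp [nestedRow]; omega
      | 3 => simp [nestedRow]; omega
      | i + 4 => simp [nestedRow]
    obtain rfl | rfl : l = 2 ∨ l = 3 := by omega
    · exact Or.inr (Or.inr (Or.inr (Or.inl ⟨by omega, c₃, v.trans rfl, t.trans rfl⟩)))
    · exact Or.inr (Or.inr (Or.inr (Or.inl ⟨by omega, c₃, v.trans rfl, t.trans rfl⟩)))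
  · obtain ⟨v, t, -⟩ := hS {1, 2} fun i => by
      match i with
      | 0 => simp [nestedRow]; omega
      | 1 => simp [nestedRow]; omega
      | 2 => simp [nestedRow]; omega
      | 3 => simp [nestedRow]; omega
      | i + 4 => simp [nestedRow]
    refine Or.inr (Or.inr (Or.inr (Or.inr ⟨by omega, ?_, ?_⟩)))
    · rw [v]
      have : 1 ≤ l ∧ l ≤ 3 := by omega
      obtain ⟨_, _⟩ := this
      interval_cases l <;> rfl
    · rw [t]
      have : 1 ≤ l ∧ l ≤ 3 := by omega
      obtain ⟨_, _⟩ := this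
      interval_cases l <;> rfl

end IsRecording

lemma map_range_add {α : Type*} (f : ℕ → α) (m n : ℕ) {u : α} (h : ∀ i < m, f i = u) :
    (List.range (m + n)).map f = List.replicate m u ++ (List.range n).map fun i => f (m + i) := by
  rw [List.range_add, List.map_append, List.map_map]
  congr 1
  rw [List.map_congr_left fun i hi => h i (List.mem_range.1 hi)]
  simp

lemma map_range_sub {α : Type*} (f : ℕ → α) {a b c d : ℕ} {t u v w : α}
    (ht : ∀ k, b + c + d < k → k ≤ a + b + c + d → f k = t)
    (hu : ∀ k, c + d < k → k ≤ b + c + d → f k = u) (hv : ∀ k, d < k → k ≤ c + d → f k = v)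
    (hw : ∀ k, 1 ≤ k → k ≤ d → f k = w) :
    ((List.range (a + b + c + d)).map fun i => f (a + b + c + d - i)) =
      List.replicate a t ++ List.replicate b u ++ List.replicate c v ++ List.replicate d w := by
  rw [show List.range (a + b + c + d) = List.range (a + (b + (c + (d + 0)))) by congr 1; omega,
    map_range_add (u := t), map_range_add (u := u), map_range_add (u := v),
    map_range_add (u := w)]
  · simp
  · exact fun i hi => hw _ (by omega) (by omega)
  · exact fun i hi => hv _ (by omega) (by omega)
  · exact fun i hi => hu _ (by omega) (by omega)
  · exact fun i hi => ht _ (by omega) (by omega)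

namespace IsRecording

variable {lam mu : YoungDiagram} {Q : ℕ → ℕ → ℕ} {p q s e b : ℕ}

/-- The number of vertical strips with slack vector `{3}` is `c`. If the third row of the
underlying tableau has no entry `2`, then there is none: all slacks are `0`. -/
lemma sequences_eq (h : IsRecording lam mu Q p q s e b) {c : ℕ}
    (hc : (e = 0 ∧ c = 0) ∨ (0 < e ∧ c = s - b)) :
    slackVectorSequence lam mu Q = List.replicate q {1} ++ List.replicate (p - s) {2} ++
      List.replicate c {3} ++ List.replicate (s - c) ∅ ∧
    slackSequence lam mu Q = List.replicate (q + (p - s) + c) 1 ++ List.replicate (s - c) 0 := by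
  have h₁ := h.twos_le
  have h₂ := h.weight
  have h₃ := h.s_le
  have h₄ := h.b_le
  have key : ∀ k, 1 ≤ k → k ≤ p + q →
      (p < k → slackVector lam mu Q k = {1} ∧ slack lam mu Q k = 1) ∧
      (s < k → k ≤ p → slackVector lam mu Q k = {2} ∧ slack lam mu Q k = 1) ∧
      (s - c < k → k ≤ s → slackVector lam mu Q k = {3} ∧ slack lam mu Q k = 1) ∧
      (k ≤ s - c → slackVector lam mu Q k = ∅ ∧ slack lam mu Q k = 0) := by
    intro k hk hk'
    rcases h.slack_cases hk hk' with ⟨g₁, v, t, -⟩ | ⟨g₁, g₂, g₃, v, t, -⟩ | ⟨g₁, g₂, g₃, v, t⟩ |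
      ⟨g₁, g₂, v, t⟩ | ⟨g₁, v, t⟩
    · exact ⟨by omega, by omega, by omega, fun _ => ⟨v, t⟩⟩
    · exact ⟨by omega, by omega, by omega, fun _ => ⟨v, t⟩⟩
    · exact ⟨by omega, by omega, fun _ _ => ⟨v, t⟩, by omega⟩
    · exact ⟨by omega, fun _ _ => ⟨v, t⟩, by omega, by omega⟩
    · exact ⟨fun _ => ⟨v, t⟩, by omega, by omega, by omega⟩
  have hN : p + q = q + (p - s) + c + (s - c) := by omega
  rw [slackVectorSequence, slackSequence, h.numStrips_eq, hN]
  constructor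
  · exact map_range_sub _ (fun k g₁ g₂ => ((key k (by omega) (by omega)).1 (by omega)).1)
      (fun k g₁ g₂ => ((key k (by omega) (by omega)).2.1 (by omega) (by omega)).1)
      (fun k g₁ g₂ => ((key k (by omega) (by omega)).2.2.1 (by omega) (by omega)).1)
      (fun k g₁ g₂ => ((key k (by omega) (by omega)).2.2.2 (by omega)).1)
  · rw [List.replicate_add, List.replicate_add]
    exact map_range_sub _ (fun k g₁ g₂ => ((key k (by omega) (by omega)).1 (by omega)).2)
      (fun k g₁ g₂ => ((key k (by omega) (by omega)).2.1 (by omega) (by omega)).2)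
      (fun k g₁ g₂ => ((key k (by omega) (by omega)).2.2.1 (by omega) (by omega)).2)
      (fun k g₁ g₂ => ((key k (by omega) (by omega)).2.2.2 (by omega)).2)

/-- Both a slack `0` and exactly two cells occur for a vertical strip only if all slacks are `0`. -/
lemma exists_slack_zero_iff (h : IsRecording lam mu Q p q s e b) :
    (∃ k ∈ Finset.Icc 1 (numStrips lam Q), slack lam mu Q k = 0 ∧ occ lam.cells Q k = 2) ↔
      e = 0 ∧ b < s := by
  have h₃ := h.s_le
  rw [h.numStrips_eq]
  constructor
  · rintro ⟨k, hk, t', o'⟩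
    obtain ⟨hk₁, hk₂⟩ := Finset.mem_Icc.1 hk
    rcases h.slack_cases hk₁ hk₂ with ⟨g₁, v, t, o⟩ | ⟨g₁, g₂, g₃, v, t, o⟩ | ⟨g₁, g₂, g₃, v, t⟩ |
      ⟨g₁, g₂, v, t⟩ | ⟨g₁, v, t⟩
    · omega
    · exact ⟨g₃, by omega⟩
    all_goals omega
  · rintro ⟨he, hs⟩
    refine ⟨s, Finset.mem_Icc.2 ⟨by omega, by omega⟩, ?_⟩
    rcases h.slack_cases (k := s) (by omega) (by omega) with ⟨g₁, v, t, o⟩ |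
      ⟨g₁, g₂, g₃, v, t, o⟩ | ⟨g₁, g₂, g₃, v, t⟩ | ⟨g₁, g₂, v, t⟩ | ⟨g₁, v, t⟩
    · omega
    · exact ⟨t, o⟩
    all_goals omega

end IsRecording

/-! ### Columns of semistandard tableaux -/

lemma dom_of_getElem {u v : List ℕ} (hl : v.length ≤ u.length)
    (h : ∀ i (hi : i < v.length), u[i] ≤ v[i]) : Dom u v := by
  induction u generalizing v with
  | nil =>
    obtain rfl : v = [] := by simpa using hl
    simp
  | cons a u ih =>
    cases v with
    | nil => simp
    | cons b v =>
      exact ⟨h 0 (by simp), ih (by simpa using hl) fun i hi => h (i + 1) (by simpa using hi)⟩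

lemma isTableau_columns {lam : YoungDiagram} {T : SemistandardYoungTableau lam}
    (hT : T ∈ SST 4 lam) : IsTableau (columns T) := by
  have hdom : ∀ j, Dom ((List.range (lam.colLen j)).map fun i => T i j)
      ((List.range (lam.colLen (j + 1))).map fun i => T i (j + 1)) := by
    intro j
    refine dom_of_getElem (by simpa using lam.colLen_anti j (j + 1) (by omega)) fun i hi => ?_
    simp only [List.length_map, List.length_range] at hi
    simpa using T.row_weak (Nat.lt_succ_self j) (YoungDiagram.mem_iff_lt_colLen.2 hi)
  have key : ∀ m l, l + m ≤ lam.rowLen 0 → lam.rowLen 0 ≤ l + m →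
      IsTableau ((List.range' l m).map fun j => (List.range (lam.colLen j)).map fun i => T i j) := by
    intro m
    induction m with
    | zero => intros; trivial
    | succ m ih =>
      intro l h₁ h₂
      have hcol : 0 < lam.colLen l := YoungDiagram.mem_iff_lt_colLen.1
        (YoungDiagram.mem_iff_lt_rowLen.2 (by omega) : (0, l) ∈ lam)
      rw [List.range'_succ, List.map_cons]
      refine ⟨by simpa [List.range_eq_nil] using hcol.ne', ?_, ?_, ?_,
        ih (l + 1) (by omega) (by omega)⟩
      · rw [List.pairwise_iff_getElem]
        intro i j hi hj hij
        simp only [List.length_map, List.length_range] at hj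
        simpa using T.col_strict hij (YoungDiagram.mem_iff_lt_colLen.2 hj)
      · intro x hx
        obtain ⟨i, hi, rfl⟩ := List.mem_map.1 hx
        exact hT i l (YoungDiagram.mem_iff_lt_colLen.2 (List.mem_range.1 hi))
      · cases m with
        | zero => simp
        | succ m =>
          rw [List.range'_succ]
          exact hdom l
  have := key (lam.rowLen 0) 0 (by omega) (by omega)
  rwa [← List.range_eq_range'] at this

lemma map_length_columns {lam : YoungDiagram} (T : SemistandardYoungTableau lam) :
    (columns T).map List.length = (List.range (lam.rowLen 0)).map lam.colLen := by
  simp [columns, Function.comp_def]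

lemma columns_injective {lam : YoungDiagram} {S T : SemistandardYoungTableau lam}
    (h : columns S = columns T) : S = T := by
  ext i j
  by_cases hij : (i, j) ∈ lam
  · have hj : (0, j) ∈ lam := lam.up_left_mem (Nat.zero_le i) le_rfl hij
    have h₁ := List.map_inj_left.1 h j
      (List.mem_range.2 (YoungDiagram.mem_iff_lt_rowLen.1 hj))
    exact List.map_inj_left.1 h₁ i (List.mem_range.2 (YoungDiagram.mem_iff_lt_colLen.1 hij))
  · rw [S.zeros hij, T.zeros hij]

lemma colLen_eq {lam : YoungDiagram} {j c : ℕ} (h : ∀ i, j < lam.rowLen i ↔ i < c) :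
    lam.colLen j = c := by
  have h' : ∀ i, i < lam.colLen j ↔ i < c := fun i => by
    rw [← h, ← YoungDiagram.mem_iff_lt_colLen, YoungDiagram.mem_iff_lt_rowLen]
  have h₁ := h' c
  have h₂ := h' (lam.colLen j)
  omega

lemma columns_highestTableau {mu : YoungDiagram} (hmu : mu.colLen 0 ≤ 2) :
    columns (highestTableau mu) =
      mixed 0 0 0 0 0 (mu.rowLen 1) (mu.rowLen 0 - mu.rowLen 1) := by
  have hle : mu.rowLen 1 ≤ mu.rowLen 0 := mu.rowLen_anti 0 1 (by omega)
  have hz : ∀ i, 2 ≤ i → mu.rowLen i = 0 := fun i hi => rowLen_eq_zero hmu hi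
  have hentry : ∀ i j, j < mu.rowLen i → highestTableau mu i j = uSeq (i + 1) := fun i j hj =>
    if_pos (YoungDiagram.mem_iff_lt_rowLen.2 hj)
  have u₁ : uSeq 1 = 2 := by decide
  have u₂ : uSeq 2 = 3 := by decide
  rw [columns, show List.range (mu.rowLen 0) =
      List.range (mu.rowLen 1 + ((mu.rowLen 0 - mu.rowLen 1) + 0)) by congr 1; omega,
    map_range_add (u := [2, 3]), map_range_add (u := [2])]
  · simp [mixed]
  · intro j hj
    rw [colLen_eq (c := 1) fun i => ?_]
    · simp [List.range_succ, hentry 0 _ (show mu.rowLen 1 + j < mu.rowLen 0 by omega), u₁]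
    · match i with
      | 0 => omega
      | 1 => omega
      | i + 2 => rw [hz (i + 2) (by omega)]; omega
  · intro j hj
    rw [colLen_eq (c := 2) fun i => ?_]
    · simp [List.range_succ, hentry 0 j (by omega), hentry 1 j hj, u₁, u₂]
    · match i with
      | 0 => omega
      | 1 => omega
      | i + 2 => rw [hz (i + 2) (by omega)]; omega

/-! ### The tableau with given multiplicities of columns -/

/-- The tableau whose first and second row consist of `1`'s and `2`'s in the columns of index less
than `D`, of `2`'s and `3`'s in the others, and whose third row consists of `3`'s in the columns of
index less than `C`, of `4`'s in the others. -/
def shiftedTableau (lam : YoungDiagram) (C D : ℕ) (hC : lam.rowLen 3 ≤ C) (hCD : C ≤ D) :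
    SemistandardYoungTableau lam where
  entry i j :=
    if (i, j) ∈ lam then i + 1 + if (i ≤ 1 ∧ D ≤ j) ∨ (2 ≤ i ∧ i ≤ 2 ∧ C ≤ j) then 1 else 0 else 0
  row_weak' {i j₁ j₂} hj hcell := by
    rw [if_pos hcell, if_pos (lam.up_left_mem le_rfl hj.le hcell)]
    split_ifs <;> omega
  col_strict' {i₁ i₂ j} hi hcell := by
    rw [if_pos hcell, if_pos (lam.up_left_mem hi.le le_rfl hcell)]
    have h₃ : i₂ = 3 → j < lam.rowLen 3 := by
      rintro rfl
      exact YoungDiagram.mem_iff_lt_rowLen.1 hcell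
    split_ifs <;> omega
  zeros' h := if_neg h

section shiftedTableau

variable {lam : YoungDiagram} {a x y p r z w : ℕ}

lemma shiftedTableau_apply {C D : ℕ} (hC : lam.rowLen 3 ≤ C) (hCD : C ≤ D) {i j : ℕ}
    (h : j < lam.rowLen i) : shiftedTableau lam C D hC hCD i j =
      i + 1 + if (i ≤ 1 ∧ D ≤ j) ∨ (2 ≤ i ∧ i ≤ 2 ∧ C ≤ j) then 1 else 0 :=
  if_pos (YoungDiagram.mem_iff_lt_rowLen.2 h)

lemma columns_shiftedTableau (hpr : p = 0 ∨ r = 0)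
    (l₀ : lam.rowLen 0 = a + x + y + p + r + z + w) (l₁ : lam.rowLen 1 = a + x + y + p + r + z)
    (l₂ : lam.rowLen 2 = a + x + y + r) (l₃ : lam.rowLen 3 = a)
    (l₄ : ∀ i, 4 ≤ i → lam.rowLen i = 0) (hC : lam.rowLen 3 ≤ a + x)
    (hCD : a + x ≤ a + x + y + p) :
    columns (shiftedTableau lam (a + x) (a + x + y + p) hC hCD) = mixed a x y p r z w := by
  have col : ∀ j c, c ≤ 4 → (∀ i < 4, j < lam.rowLen i ↔ i < c) → lam.colLen j = c := by
    intro j c hc h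
    refine colLen_eq fun i => ?_
    by_cases hi : i < 4
    · exact h i hi
    · rw [l₄ i (by omega)]
      omega
  have ap : ∀ i j, j < lam.rowLen i →
      shiftedTableau lam (a + x) (a + x + y + p) hC hCD i j =
        i + 1 + if (i ≤ 1 ∧ a + x + y + p ≤ j) ∨ (2 ≤ i ∧ i ≤ 2 ∧ a + x ≤ j) then 1 else 0 :=
    fun i j h => shiftedTableau_apply hC hCD h
  generalize shiftedTableau lam (a + x) (a + x + y + p) hC hCD = T at ap
  have hcol : ∀ j (u : List ℕ), u.length ≤ 4 → (∀ i < 4, j < lam.rowLen i ↔ i < u.length) →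
      (∀ i (hi : i < u.length), u[i] =
        i + 1 + if (i ≤ 1 ∧ a + x + y + p ≤ j) ∨ (2 ≤ i ∧ i ≤ 2 ∧ a + x ≤ j) then 1 else 0) →
      (List.range (lam.colLen j)).map (fun i => T i j) = u := by
    intro j u hu h₁ h₂
    rw [col j _ hu h₁]
    refine List.ext_getElem (by simp) fun i hi hi' => ?_
    rw [h₂ i hi', List.getElem_map, List.getElem_range]
    exact ap i j ((h₁ i (by omega)).2 hi')
  rw [columns, show List.range (lam.rowLen 0) =
      List.range (a + (x + (y + (p + (r + (z + (w + 0))))))) by congr 1; omega,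
    map_range_add (u := [1, 2, 3, 4]), map_range_add (u := [1, 2, 3]),
    map_range_add (u := [1, 2, 4]), map_range_add (u := [1, 2]), map_range_add (u := [2, 3, 4]),
    map_range_add (u := [2, 3]), map_range_add (u := [2])]
  · simp [mixed]
  all_goals
    intro j hj
    refine hcol _ _ (by simp) ?_ ?_
    · intro i hi
      simp only [List.length_cons, List.length_nil]
      interval_cases i <;> omega
    · intro i hi
      simp only [List.length_cons, List.length_nil] at hi
      interval_cases i <;> simp only [List.getElem_cons_zero, List.getElem_cons_succ] <;>
        split_ifs <;> omega

lemma shiftedTableau_mem_SST (l₄ : ∀ i, 4 ≤ i → lam.rowLen i = 0) {C D : ℕ}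
    (hC : lam.rowLen 3 ≤ C) (hCD : C ≤ D) : shiftedTableau lam C D hC hCD ∈ SST 4 lam := by
  intro i j hij
  rw [YoungDiagram.mem_iff_lt_rowLen] at hij
  have hi : i < 4 := by
    by_contra hi
    rw [l₄ i (by omega)] at hij
    omega
  rw [shiftedTableau_apply hC hCD hij]
  split_ifs <;> omega

lemma kWeight_shiftedTableau (hlam : lam.colLen 0 ≤ 4) {C D : ℕ} (hC : lam.rowLen 3 ≤ C)
    (hCD : C ≤ D) (hC₂ : C ≤ lam.rowLen 2) (hD : D ≤ lam.rowLen 1) :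
    kWeight (shiftedTableau lam C D hC hCD) 1 = lam.rowLen 0 - D ∧
    kWeight (shiftedTableau lam C D hC hCD) 2 =
      lam.rowLen 1 - D + C - (lam.rowLen 2 - C) - lam.rowLen 3 := by
  have hle : lam.rowLen 1 ≤ lam.rowLen 0 := lam.rowLen_anti 0 1 (by omega)
  have ap : ∀ i j, j < lam.rowLen i → shiftedTableau lam C D hC hCD i j =
      i + 1 + if (i ≤ 1 ∧ D ≤ j) ∨ (2 ≤ i ∧ i ≤ 2 ∧ C ≤ j) then 1 else 0 :=
    fun i j h => shiftedTableau_apply hC hCD h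
  generalize shiftedTableau lam C D hC hCD = T at ap ⊢
  have hrow : ∀ i k (P : ℕ → Prop), (∀ j, j < lam.rowLen i →
      ((i + 1 + if (i ≤ 1 ∧ D ≤ j) ∨ (2 ≤ i ∧ i ≤ 2 ∧ C ≤ j) then 1 else 0) = k ↔ P j)) →
      ∀ j, (j < lam.rowLen i ∧ T i j = k) ↔ (j < lam.rowLen i ∧ P j) := by
    intro i k P h j
    refine and_congr_right fun hj => ?_
    rw [ap i j hj, h j hj]
  have o₁ : occ lam.cells T 1 = (D - 0) + (0 - 0) + (0 - 0) + (0 - 0) := by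
    refine card_filter_cells hlam _ ?_ ?_ ?_ ?_ <;> intro j <;>
      refine (hrow _ _ (fun j => _) (fun j _ => Iff.rfl) j).trans ?_ <;> split_ifs <;> omega
  have o₂ : occ lam.cells T 2 = (lam.rowLen 0 - D) + (D - 0) + (0 - 0) + (0 - 0) := by
    refine card_filter_cells hlam _ ?_ ?_ ?_ ?_ <;> intro j <;>
      refine (hrow _ _ (fun j => _) (fun j _ => Iff.rfl) j).trans ?_ <;> split_ifs <;> omega
  have o₃ : occ lam.cells T 3 = (0 - 0) + (lam.rowLen 1 - D) + (C - 0) + (0 - 0) := by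
    refine card_filter_cells hlam _ ?_ ?_ ?_ ?_ <;> intro j <;>
      refine (hrow _ _ (fun j => _) (fun j _ => Iff.rfl) j).trans ?_ <;> split_ifs <;> omega
  have o₄ : occ lam.cells T 4 = (0 - 0) + (0 - 0) + (lam.rowLen 2 - C) + (lam.rowLen 3 - 0) := by
    refine card_filter_cells hlam _ ?_ ?_ ?_ ?_ <;> intro j <;>
      refine (hrow _ _ (fun j => _) (fun j _ => Iff.rfl) j).trans ?_ <;> split_ifs <;> omega
  have u₁ : uSeq 1 = 2 := by decide
  have u₂ : uSeq 2 = 3 := by decide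
  have v₁ : vSeq 1 = 1 := by decide
  have v₂ : vSeq 2 = 4 := by decide
  rw [kWeight, kWeight, u₁, u₂, v₁, v₂, o₁, o₂, o₃, o₄]
  constructor <;> omega

end shiftedTableau

lemma QAII_eq_of_hasCell {t : List (List ℕ)} {mu : YoungDiagram} {Q : ℕ → ℕ → ℕ}
    (hmu : ∀ i j, (i, j) ∈ mu → Q i j = 0)
    (h : ∀ i j k, HasCell (suc^[k] t) i j ↔ (i, j) ∈ mu ∨ k < Q i j) : QAII t = Q := by
  funext i j
  unfold QAII
  by_cases hm : (i, j) ∈ mu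
  · have : {k | ¬ HasCell (suc^[k] t) i j} = ∅ := by
      ext k
      simp [h, hm]
    rw [this, Nat.sInf_empty, hmu i j hm]
  · have : {k | ¬ HasCell (suc^[k] t) i j} = Set.Ici (Q i j) := by
      ext k
      simp [h, hm]
    rw [this, csInf_Ici]

/-- The shapes of the successors of a tableau of the first or the second type. -/
lemma hasCell_iterate_suc_mixed {mu : YoungDiagram} {a x y p r z w : ℕ} (hx : x ≤ w) (hy : y ≤ z)
    (hpr : p = 0 ∨ r = 0) (m₀ : mu.rowLen 0 = r + z + w) (m₁ : mu.rowLen 1 = z - y + x)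
    (i j k : ℕ) :
    HasCell (suc^[k] (mixed a x y p r z w)) i j ↔
      j < nestedRow mu (a + p + y + x) (y + r) (a + p + y) (x + y + r) a k i := by
  rw [iterate_suc_mixed hx hy hpr, hasCell_mixed (by omega)]
  have row : ∀ i, nestedRow mu (a + p + y + x) (y + r) (a + p + y) (x + y + r) a k i =
      if i = 0 then r + z + w + (a + p + y + x - k) else
      if i = 1 then z - y + x + (a + p + y - k) + min (y + r) (a + p + y + x + (y + r) - k) else
      if i = 2 then (a - k) + min (x + y + r) (a + p + y + (x + y + r) - k) else
      if i = 3 then a - k else 0 := by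
    intro i
    match i with
    | 0 => simp only [nestedRow, m₀]; rfl
    | 1 => simp only [nestedRow, m₁]; rfl
    | 2 => rfl
    | 3 => rfl
    | i + 4 => rfl
  rw [row]
  clear row m₀ m₁
  obtain ⟨z, rfl⟩ := Nat.exists_eq_add_of_le hy
  obtain ⟨w, rfl⟩ := Nat.exists_eq_add_of_le hx
  -- The case distinction by the kind of the column that the `k`-th step removes.
  obtain h | ⟨l, rfl⟩ : k ≤ a ∨ ∃ l, k = a + l :=
    (Nat.le_total k a).imp_right Nat.exists_eq_add_of_le
  · simp only [show k - a = 0 by omega, show k - (a + p) = 0 by omega,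
      show k - (a + p + y) = 0 by omega, show k - (a + p + y + x) = 0 by omega, Nat.sub_zero,
      Nat.min_zero, Nat.add_zero]
    split_ifs <;> omega
  simp only [Nat.add_assoc, Nat.add_sub_cancel_left, Nat.add_sub_add_left, Nat.sub_self_add]
  obtain h | ⟨l, rfl⟩ : l ≤ p ∨ ∃ l', l = p + l' :=
    (Nat.le_total l p).imp_right Nat.exists_eq_add_of_le
  · simp only [show l - p = 0 by omega, show l - (p + y) = 0 by omega,
      show l - (p + (y + x)) = 0 by omega, Nat.sub_zero, Nat.min_zero, Nat.add_zero]
    split_ifs <;> omega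
  simp only [Nat.add_sub_cancel_left, Nat.add_sub_add_left, Nat.sub_self_add]
  obtain h | ⟨l, rfl⟩ : l ≤ y ∨ ∃ l', l = y + l' :=
    (Nat.le_total l y).imp_right Nat.exists_eq_add_of_le
  · simp only [show l - y = 0 by omega, show l - (y + x) = 0 by omega, Nat.sub_zero, Nat.min_zero,
      Nat.add_zero, Nat.min_eq_right h]
    split_ifs <;> omega
  simp only [Nat.add_sub_cancel_left, Nat.add_sub_add_left, Nat.sub_self_add, Nat.min_eq_left
    (Nat.le_add_right y l)]
  obtain h | ⟨l, rfl⟩ : l ≤ x ∨ ∃ l', l = x + l' :=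
    (Nat.le_total l x).imp_right Nat.exists_eq_add_of_le
  · simp only [show l - x = 0 by omega, Nat.sub_zero, Nat.min_zero, Nat.add_zero,
      Nat.min_eq_right h]
    split_ifs <;> omega
  simp only [Nat.add_sub_cancel_left, Nat.add_sub_add_left, Nat.sub_self_add, Nat.min_eq_left
    (Nat.le_add_right x l)]
  split_ifs <;> omega

/-- The recording tableau of a tableau of the first or the second type: the strip removed by the
`k`-th step is the `k`-th strip of `Q`. -/
lemma IsRecording.QAII_mixed {lam mu : YoungDiagram} {Q : ℕ → ℕ → ℕ} {p q s e b : ℕ}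
    (h : IsRecording lam mu Q p q s e b) :
    QAII (mixed b (p - s) (min q (s - b)) (s - b - q) (q - (s - b))
      (lam.rowLen 1 - lam.rowLen 2 - (s - b - q)) (lam.rowLen 0 - lam.rowLen 1)) = Q := by
  refine QAII_eq_of_hasCell (mu := mu) (fun i j => h.eq_zero_of_mem) fun i j k => ?_
  rw [← h.lt_nestedRow_iff]
  obtain ⟨l₀, l₁, l₂, l₃, l₄, m₂, h₁, h₂, h₃, h₄, h₅, r₀, r₁, r₂, r₃, r₄⟩ := h
  clear r₀ r₁ r₂ r₃ r₄ m₂ l₄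
  rw [hasCell_iterate_suc_mixed (mu := mu) (by omega) (by omega) (by omega) (by omega) (by omega),
    show b + (s - b - q) + min q (s - b) + (p - s) = p by omega,
    show min q (s - b) + (q - (s - b)) = q by omega,
    show b + (s - b - q) + min q (s - b) = s by omega,
    show p - s + min q (s - b) + (q - (s - b)) = e by omega]

end QuantumLR

theorem mainTheorem5 (lam mu : YoungDiagram) (hlam : lam.colLen 0 ≤ 4) (hmu : mu.colLen 0 ≤ 2)
    (hsub : mu ≤ lam) (Q : ℕ → ℕ → ℕ) (hQ : Q ∈ Rec 2 lam mu) :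
    (∃ a b c d : ℕ,
      slackSequence lam mu Q = List.replicate (a + b + c) 1 ++ List.replicate d 0 ∧
      slackVectorSequence lam mu Q =
        List.replicate a {1} ++ List.replicate b {2} ++ List.replicate c {3} ++
          List.replicate d ∅) ∧
    ∃ T : SemistandardYoungTableau lam,
      (∀ T' : SemistandardYoungTableau lam,
        (T' ∈ SST 4 lam ∧ LRAII T' = (columns (highestTableau mu), Q)) ↔ T' = T) ∧
      IsKHighest 2 T ∧
      (∀ k ∈ Finset.Icc 1 2, kWeight T k = mu.rowLen (k - 1)) ∧
      (IsType1 T ∨ IsType2 T) ∧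
      (columns T).count [1, 2, 3] ≤ (columns T).count [2] ∧
      (columns T).count [1, 2, 4] ≤ (columns T).count [2, 3] ∧
      ((slackVectorSequence lam mu Q).count {1} < (slackVectorSequence lam mu Q).count {3} →
        IsType1 T) ∧
      ((∃ k ∈ Finset.Icc 1 (numStrips lam Q), slack lam mu Q k = 0 ∧ occ lam.cells Q k = 2) →
        (∀ t ∈ slackSequence lam mu Q, t = 0) ∧ IsType1 T ∧ ¬ IsType2 T) ∧
      ((¬ ∃ k ∈ Finset.Icc 1 (numStrips lam Q), slack lam mu Q k = 0 ∧ occ lam.cells Q k = 2) →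
        (IsType2 T ↔
          (slackVectorSequence lam mu Q).count {3} ≤
            (slackVectorSequence lam mu Q).count {1})) := by
  obtain ⟨T₀, hT₀, rfl⟩ := hQ
  obtain ⟨p, q, s, e, b, h⟩ := hT₀.isRecording hlam hmu hsub
  generalize lozenge lam T₀ = Q at h ⊢
  obtain ⟨c, hc⟩ : ∃ c, (e = 0 ∧ c = 0) ∨ (0 < e ∧ c = s - b) := by
    rcases Nat.eq_zero_or_pos e with he | he
    · exact ⟨0, Or.inl ⟨he, rfl⟩⟩
    · exact ⟨s - b, Or.inr ⟨he, rfl⟩⟩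
  obtain ⟨hvec, hsl⟩ := h.sequences_eq hc
  have hQT := h.QAII_mixed
  have hex := h.exists_slack_zero_iff
  have count₁ : (slackVectorSequence lam mu Q).count {1} = q := by
    rw [hvec]
    simp [List.count_append, List.count_replicate]
  have count₃ : (slackVectorSequence lam mu Q).count {3} = c := by
    rw [hvec]
    simp [List.count_append, List.count_replicate]
  rw [count₁, count₃, hex]
  clear count₁ count₃ hex
  obtain ⟨l₀, l₁, l₂, l₃, l₄, m₂, h₁, h₂, h₃, h₄, h₅, -, -, -, -, -⟩ := h
  refine ⟨⟨q, p - s, c, s - c, hsl, hvec⟩, ?_⟩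
  -- The multiplicities of the columns; `n₁₂` or `n₂₃₄` vanishes.
  obtain ⟨n₁₂₃, e₁⟩ : ∃ m, m = p - s := ⟨_, rfl⟩
  obtain ⟨n₁₂₄, e₂⟩ : ∃ m, m = min q (s - b) := ⟨_, rfl⟩
  obtain ⟨n₁₂, e₃⟩ : ∃ m, m = s - b - q := ⟨_, rfl⟩
  obtain ⟨n₂₃₄, e₄⟩ : ∃ m, m = q - (s - b) := ⟨_, rfl⟩
  obtain ⟨n₂₃, e₅⟩ : ∃ m, m = lam.rowLen 1 - lam.rowLen 2 - n₁₂ := ⟨_, rfl⟩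
  obtain ⟨n₂, e₆⟩ : ∃ m, m = lam.rowLen 0 - lam.rowLen 1 := ⟨_, rfl⟩
  rw [← e₁, ← e₂, ← e₃, ← e₄, ← e₅, ← e₆] at hQT
  have hpr : n₁₂ = 0 ∨ n₂₃₄ = 0 := by omega
  have f₁ : p = s + n₁₂₃ := by omega
  have f₂ : s = b + n₁₂₄ + n₁₂ := by omega
  have f₃ : q = n₁₂₄ + n₂₃₄ := by omega
  have f₄ : lam.rowLen 1 = lam.rowLen 2 + n₁₂ + n₂₃ := by omega
  have f₅ : lam.rowLen 0 = lam.rowLen 1 + n₂ := by omega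
  clear e₁ e₂ e₃ e₄ e₅ e₆
  have hC : lam.rowLen 3 ≤ b + n₁₂₃ := by omega
  have hCD : b + n₁₂₃ ≤ b + n₁₂₃ + n₁₂₄ + n₁₂ := by omega
  have hcol := columns_shiftedTableau (lam := lam) (a := b) (x := n₁₂₃) (y := n₁₂₄) (p := n₁₂)
    (r := n₂₃₄) (z := n₂₃) (w := n₂) hpr (by omega) (by omega) (by omega) (by omega) l₄ hC hCD
  have hsst := shiftedTableau_mem_SST l₄ hC hCD
  have hwt := kWeight_shiftedTableau hlam hC hCD (by omega) (by omega)
  generalize shiftedTableau lam (b + n₁₂₃) (b + n₁₂₃ + n₁₂₄ + n₁₂) hC hCD = T at hcol hsst hwt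
  have hP : PAII (columns T) = columns (highestTableau mu) := by
    rw [hcol, PAII_mixed (by omega) (by omega) hpr, columns_highestTableau hmu]
    congr 1 <;> omega
  have hQ : QAII (columns T) = Q := by rw [hcol, hQT]
  have type₁ : n₂₃₄ = 0 → IsType1 T := fun h₀ =>
    ⟨b, n₁₂₃, n₁₂₄, n₁₂, n₂₃, n₂, by rw [hcol, h₀]; simp [mixed]⟩
  have type₂ : n₁₂ = 0 ↔ IsType2 T := by
    constructor
    · exact fun h₀ => ⟨b, n₁₂₃, n₁₂₄, n₂₃₄, n₂₃, n₂, by rw [hcol, h₀]; simp [mixed]⟩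
    · rintro ⟨a, x, y, r, z, w, h₀⟩
      have := congrArg (List.count [1, 2]) (hcol.symm.trans h₀)
      simpa [mixed, List.count_append, List.count_replicate] using this
  refine ⟨T, fun T' => ⟨?_, ?_⟩, ⟨mu, hmu, hP⟩, ?_, ?_, ?_, ?_, ?_, ?_, ?_⟩
  · rintro ⟨hT', hLR⟩
    rw [LRAII, Prod.mk.injEq] at hLR
    exact columns_injective (PAII_QAII_injective (isTableau_columns hT') (isTableau_columns hsst)
      (by rw [map_length_columns, map_length_columns]) (hLR.1.trans hP.symm) (hLR.2.trans hQ.symm))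
  · rintro rfl
    exact ⟨hsst, by rw [LRAII, hP, hQ]⟩
  · intro k hk
    obtain ⟨hk₁, hk₂⟩ := Finset.mem_Icc.1 hk
    interval_cases k
    · rw [hwt.1, Nat.sub_self]
      omega
    · rw [hwt.2, show 2 - 1 = 1 from rfl]
      omega
  · exact hpr.symm.imp type₁ type₂.1
  · rw [hcol]
    simp [mixed, List.count_append, List.count_replicate]
    omega
  · rw [hcol]
    simp [mixed, List.count_append, List.count_replicate]
    omega
  · exact fun _ => type₁ (by omega)
  · rintro ⟨he, hs⟩
    refine ⟨fun t ht => ?_, type₁ (by omega), fun ht => ?_⟩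
    · rw [hsl, show q + (p - s) + c = 0 by omega] at ht
      simpa using (List.mem_replicate.1 (by simpa using ht)).2
    · have := type₂.2 ht
      omega
  · intro hn
    rw [← type₂]
    omega
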